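/- Let $d\ge 1$ and $k\ge 1$ be fixed integers, and let $f:\mathbb{R}^d\to[0,\infty)$ be a bounded measurable function with $\int_{\mathbb{R}^d} f(x)\,dx=1$. For each $n$ let $r=r(n)\ge 0$ and let $\rho=\rho(n)=(p_1,p_2,\dots)$, $p_i=p_i(n)\in[0,1]$. Let $X_1,\dots,X_n$ be independent random points of $\mathbb{R}^d$ with density $f$. The soft random Vietoris–Rips complex $R(n,r,\rho)$ is the random simplicial complex with vertex set $\{X_1,\dots,X_n\}$ built dimension by dimension: given the points and the simplices of dimension less than $i$ (where $i\ge 1$), each set $\sigma$ of $i+1$ vertices such that $B(X_a,\frac r2)\cap B(X_b,\frac r2)\neq\emptyset$ for all $X_a,X_b\in\sigma$ (closed balls) and such that all proper nonempty subsets of $\sigma$ are simplices is included as an $i$-simplex with probability $p_i$, independently of all other choices. Let $\beta_k(R(n,r,\rho))$ be its $k$-th Betti number, the dimension of the $k$-th simplicial homology with coefficients in a fixed field (an arbitrary one, for instance $\mathbb{Q}$). Assume that $(1-p_{k+1})\prod_{i=1}^{k}p_i^{\binom{k+1}{i}}\neq 0$ for all large $n$ and that $$\lim_{n\to\infty}\frac{n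 r^d}{(1-p_{k+1})\prod_{i=1}^{k}p_i^{\binom{k+1}{i}}}=0 .$$ (1) If $(1-p_{k+1})\prod_{i=1}^{k}p_i^{\binom{k+2}{i+1}}\,n^{k+2}r^{d(k+1)}\to 0$ as $n\to\infty$, then $\mathbb{P}\big(\beta_k(R(n,r,\rho))=0\big)\to 1$. (2) If $(1-p_{k+1})\prod_{i=1}^{k}p_i^{\binom{k+2}{i+1}}\,n^{k+2}r^{d(k+1)}\to \infty$ as $n\to\infty$, then $\mathbb{P}\big(\beta_k(R(n,r,\rho))\neq 0\big)\to 1$. -/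

import Mathlib

-- Mathlib itself is compiled with this value; quotients of submodules of `α →₀ F` need it.
set_option maxSynthPendingDepth 3

open MeasureTheory Filter Topology

noncomputable section

namespace AbstractSimplicialComplex

variable {V : Type*} [LinearOrder V]

/-- The `m`-element faces of `K`, that is, its simplices of dimension `m - 1`. -/
abbrev FacesOfCard (K : AbstractSimplicialComplex V) (m : ℕ) : Type _ :=
  {σ : Finset V // σ ∈ K.faces ∧ σ.card = m}

/-- Simplicial chains of `K` with coefficients in `F`, spanned by the faces with `m` vertices
(so the chains of dimension `k` are `K.Chains F (k + 1)`). Each face is oriented by the order of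
its vertices. -/
abbrev Chains (F : Type*) [Field F] (K : AbstractSimplicialComplex V) (m : ℕ) : Type _ :=
  K.FacesOfCard m →₀ F

open Classical in
/-- The boundary of one oriented simplex `σ = [v₀ < ⋯ < v_m]`, namely
`∑ᵢ (-1)ⁱ [v₀, …, v̂ᵢ, …, v_m]`. The index `i` of a vertex `v` is the number of vertices of `σ`
below `v`. The deleted set is always a face unless `σ` is a vertex, when it is empty and the
boundary is zero. -/
def simplexBoundary (F : Type*) [Field F] (K : AbstractSimplicialComplex V) (m : ℕ)
    (σ : K.FacesOfCard (m + 1)) : K.Chains F m :=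
  ∑ v ∈ σ.1,
    if h : σ.1.erase v ∈ K.faces ∧ (σ.1.erase v).card = m then
      Finsupp.single ⟨σ.1.erase v, h⟩ ((-1 : F) ^ (σ.1.filter (· < v)).card)
    else 0

/-- The simplicial boundary operator, from chains on faces with `m + 1` vertices to chains on
faces with `m` vertices. -/
def boundary (F : Type*) [Field F] (K : AbstractSimplicialComplex V) (m : ℕ) :
    K.Chains F (m + 1) →ₗ[F] K.Chains F m :=
  Finsupp.linearCombination F (K.simplexBoundary F m)

/-- The `k`-th simplicial homology `ker ∂_k / im ∂_{k+1}` with coefficients in `F`. -/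
abbrev Homology (F : Type*) [Field F] (K : AbstractSimplicialComplex V) (k : ℕ) : Type _ :=
  LinearMap.ker (K.boundary F k) ⧸
    (LinearMap.range (K.boundary F (k + 1))).submoduleOf (LinearMap.ker (K.boundary F k))

/-- The `k`-th Betti number, `dim H_k(K; F)`. -/
def betti (F : Type*) [Field F] (K : AbstractSimplicialComplex V) (k : ℕ) : ℕ :=
  Module.finrank F (K.Homology F k)

end AbstractSimplicialComplex

namespace SoftRips

/-- The Vietoris–Rips complex on the points `x 0, …, x (n - 1)` at scale `r`: a nonempty set of
indices is a face iff the closed balls of radius `r / 2` around its points meet pairwise. The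
vertices are the indices of the points. -/
def rips {d n : ℕ} (x : Fin n → EuclideanSpace ℝ (Fin d)) (r : ℝ) :
    AbstractSimplicialComplex (Fin n) where
  faces := {σ | σ.Nonempty ∧ ∀ i ∈ σ, ∀ j ∈ σ, i ≠ j →
    (Metric.closedBall (x i) (r / 2) ∩ Metric.closedBall (x j) (r / 2)).Nonempty}
  isRelLowerSet_faces := fun _ h =>
    ⟨h.1, fun _ hts ht => ⟨ht, fun i hi j hj hij => h.2 i (hts hi) j (hts hj) hij⟩⟩
  singleton_mem := fun v => ⟨Finset.singleton_nonempty v, fun _ hi _ hj hij =>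
    absurd ((Finset.mem_singleton.1 hi).trans (Finset.mem_singleton.1 hj).symm) hij⟩

/-- The sets of at least two vertices, i.e. the potential simplices of dimension at least one. -/
abbrev PotentialSimplex (n : ℕ) : Type :=
  {τ : Finset (Fin n) // 2 ≤ τ.card}

/-- The soft Vietoris–Rips complex for the points `x`, the scale `r` and the outcomes `c` of the
coins attached to the potential simplices: a face of the Vietoris–Rips complex is kept iff its
own coin and the coins of all its faces of positive dimension show `true`. Equivalently,
dimension by dimension, a Vietoris–Rips simplex whose proper faces have all been kept is kept
iff its own coin shows `true`. -/
def softRips {d n : ℕ} (x : Fin n → EuclideanSpace ℝ (Fin d)) (r : ℝ)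
    (c : PotentialSimplex n → Bool) : AbstractSimplicialComplex (Fin n) where
  faces := {σ | σ ∈ (rips x r).faces ∧ ∀ τ : PotentialSimplex n, τ.1 ⊆ σ → c τ = true}
  isRelLowerSet_faces := fun _ h =>
    ⟨((rips x r).isRelLowerSet_faces h.1).1, fun _ hts ht =>
      ⟨((rips x r).isRelLowerSet_faces h.1).2 hts ht, fun τ hτ => h.2 τ (hτ.trans hts)⟩⟩
  singleton_mem := fun v => ⟨(rips x r).singleton_mem v, fun τ hτ => by
    have h1 := Finset.card_le_card hτ
    have h2 := τ.2
    rw [Finset.card_singleton] at h1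
    omega⟩

/-- The outcomes of the random experiment: the `n` points and the coins. -/
abbrev Outcome (d n : ℕ) : Type :=
  (Fin n → EuclideanSpace ℝ (Fin d)) × (PotentialSimplex n → Bool)

/-- The law of the random experiment: the `n` points are independent with density `f`, the coin
of a potential simplex of dimension `i` shows `true` with probability `p i`, and all points and
all coins are independent. (The entry `p 0` is not used.) -/
def law {d : ℕ} (f : EuclideanSpace ℝ (Fin d) → ℝ) (p : ℕ → unitInterval) (n : ℕ) :
    Measure (Outcome d n) :=
  (Measure.pi fun _ : Fin n => volume.withDensity fun x => ENNReal.ofReal (f x)).prod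
    (Measure.pi fun τ : PotentialSimplex n =>
      ProbabilityTheory.bernoulliMeasure true false (p (τ.1.card - 1)))

end SoftRips

end

/-! Write t = n r^d, D for the denominator in the hypothesis and Q for the quantity in (1) and (2).
Up to constants, and for r ≤ 1, Q is the expected number of hollow (k+1)-simplices: k+2 points at
mutual distance at most r whose simplices of dimension at most k pass their coins while the top one
fails.

For (1), a nonzero class requires a hollow (k+1)-simplex or a k-face with two distinct outside
neighbours (`betti_eq_zero`). The second kind puts k+3 points within distance 3r; keeping only the
coins of the k-face bounds the expected number by a constant times n^(k+3) r^(d(k+2)) ∏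
p_i^C(k+1,i+1). By Pascal's rule this is Q · t/D, which is where the hypothesis t/D → 0 enters. A
union bound concludes.

For (2), an isolated hollow simplex carries a nonzero class (`betti_ne_zero`). The variance of the
number of hollow simplices is O(Q), so by Chebyshev this number is at least half its mean with
probability 1 - O(1/Q). The expected number of hollow simplices with a further point nearby is
O(Qt), and t → 0 because D ≤ 1; by Markov these cannot account for all of them. The geometric inputs
are `measureReal_clustered_le` and `exists_measureReal_clustered_ge`. -/

namespace AbstractSimplicialComplex

/-! ### Boundaries of hollow simplices and criteria for the Betti number -/

variable {V : Type*} [LinearOrder V] {F : Type*} [Field F]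

theorem mem_faces_of_subset {V : Type*} {K : AbstractSimplicialComplex V} {s t : Finset V}
    (hs : s ∈ K.faces) (hts : t ⊆ s) (ht : t.Nonempty) : t ∈ K.faces :=
  (K.isRelLowerSet_faces hs).2 hts ht

open Classical in
/-- The chain `a • ρ` if `ρ` is a face with `m` vertices, and zero otherwise. -/
noncomputable def faceSingle {V : Type*} (K : AbstractSimplicialComplex V) (m : ℕ) (ρ : Finset V) (a : F) :
    K.Chains F m :=
  if h : ρ ∈ K.faces ∧ ρ.card = m then Finsupp.single ⟨ρ, h⟩ a else 0

variable (F) in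
/-- The alternating sum of the facets of a set of vertices that need not itself be a face. -/
noncomputable def facetChain (K : AbstractSimplicialComplex V) (m : ℕ) (τ : Finset V) :
    K.Chains F m :=
  ∑ v ∈ τ, K.faceSingle m (τ.erase v) ((-1 : F) ^ (τ.filter (· < v)).card)

theorem simplexBoundary_eq_facetChain (K : AbstractSimplicialComplex V) (m : ℕ)
    (σ : K.FacesOfCard (m + 1)) : K.simplexBoundary F m σ = K.facetChain F m σ.1 := rfl

theorem boundary_faceSingle (K : AbstractSimplicialComplex V) (m : ℕ) {ρ : Finset V} (a : F)
    (hρ : ρ ∈ K.faces) (hc : ρ.card = m + 1) :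
    K.boundary F m (K.faceSingle (m + 1) ρ a) = a • K.facetChain F m ρ := by
  rw [faceSingle, dif_pos ⟨hρ, hc⟩, boundary, Finsupp.linearCombination_single,
    simplexBoundary_eq_facetChain]

theorem smul_faceSingle {V : Type*} (K : AbstractSimplicialComplex V) (m : ℕ) (ρ : Finset V) (a b : F) :
    a • K.faceSingle m ρ b = K.faceSingle m ρ (a * b) := by
  unfold faceSingle
  split_ifs <;> simp

theorem faceSingle_add {V : Type*} (K : AbstractSimplicialComplex V) (m : ℕ) (ρ : Finset V) (a b : F) :
    K.faceSingle m ρ (a + b) = K.faceSingle m ρ a + K.faceSingle m ρ b := by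
  unfold faceSingle
  split_ifs <;> simp

theorem faceSingle_zero {V : Type*} (K : AbstractSimplicialComplex V) (m : ℕ) (ρ : Finset V) :
    K.faceSingle m ρ (0 : F) = 0 := by
  unfold faceSingle
  split_ifs <;> simp

/-- For u < v, deleting v leaves the position of u unchanged, while deleting u lowers that of v by
one; the two orders of deletion thus have opposite signs. -/
theorem sign_erase_add_sign_erase {τ : Finset V} {u v : V} (hu : u ∈ τ) (hv : v ∈ τ)
    (huv : u ≠ v) :
    (-1 : F) ^ (τ.filter (· < v)).card * (-1) ^ ((τ.erase v).filter (· < u)).card +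
      (-1) ^ (τ.filter (· < u)).card * (-1) ^ ((τ.erase u).filter (· < v)).card = 0 := by
  wlog h : u < v generalizing u v
  · rw [add_comm]
    exact this hv hu huv.symm (lt_of_le_of_ne (not_lt.1 h) huv.symm)
  have h1 : (τ.erase v).filter (· < u) = τ.filter (· < u) := by
    ext x
    simp only [Finset.mem_filter, Finset.mem_erase]
    exact ⟨fun hx => ⟨hx.1.2, hx.2⟩, fun hx => ⟨⟨(hx.2.trans h).ne, hx.1⟩, hx.2⟩⟩
  have h2 : (τ.filter (· < v)).card = ((τ.erase u).filter (· < v)).card + 1 := by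
    rw [Finset.filter_erase, Finset.card_erase_add_one]
    simp [hu, h]
  rw [h1, h2]
  ring

/-- This is ∂∂ = 0, with only the facets required to be faces so that it covers hollow simplices.
Swapping the two deleted vertices is a sign-reversing involution. -/
theorem boundary_facetChain (K : AbstractSimplicialComplex V) (m : ℕ) {τ : Finset V}
    (hc : τ.card = m + 2) (hτ : ∀ v ∈ τ, τ.erase v ∈ K.faces) :
    K.boundary F m (K.facetChain F (m + 1) τ) = 0 := by
  have h1 : K.boundary F m (K.facetChain F (m + 1) τ) = ∑ v ∈ τ, ∑ u ∈ τ.erase v,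
      K.faceSingle m ((τ.erase v).erase u) ((-1 : F) ^ (τ.filter (· < v)).card *
        (-1) ^ ((τ.erase v).filter (· < u)).card) := by
    rw [facetChain, map_sum]
    refine Finset.sum_congr rfl fun v hv => ?_
    rw [boundary_faceSingle K m _ (hτ v hv) (by rw [Finset.card_erase_of_mem hv, hc]; rfl),
      facetChain, Finset.smul_sum]
    exact Finset.sum_congr rfl fun u _ => smul_faceSingle ..
  rw [h1, Finset.sum_sigma']
  refine Finset.sum_involution (fun x _ => ⟨x.2, x.1⟩) ?_ ?_ ?_ ?_
  · rintro ⟨v, u⟩ h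
    simp only [Finset.mem_sigma, Finset.mem_erase] at h
    dsimp only
    rw [Finset.erase_right_comm (a := u), ← faceSingle_add,
      sign_erase_add_sign_erase h.2.2 h.1 h.2.1, faceSingle_zero]
  · rintro ⟨v, u⟩ h _ he
    simp only [Finset.mem_sigma, Finset.mem_erase] at h
    simp only [Sigma.mk.injEq] at he
    exact h.2.1 he.1
  · rintro ⟨v, u⟩ h
    simp only [Finset.mem_sigma, Finset.mem_erase] at h ⊢
    exact ⟨h.2.2, h.2.1.symm, h.1⟩
  · rintro ⟨v, u⟩ _
    rfl

theorem faceSingle_apply (K : AbstractSimplicialComplex V) (m : ℕ) (ρ : Finset V) (a : F)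
    (σ : K.FacesOfCard m) : K.faceSingle m ρ a σ = if σ.1 = ρ then a else 0 := by
  unfold faceSingle
  by_cases h : ρ ∈ K.faces ∧ ρ.card = m
  · rw [dif_pos h, Finsupp.single_apply]
    simp only [Subtype.ext_iff, eq_comm]
  · rw [dif_neg h, if_neg (by rintro rfl; exact h σ.2)]
    rfl

/-- Distinct vertices have distinct opposite facets, so the coefficients ±1 never meet and cannot
cancel in any characteristic. -/
theorem facetChain_apply_ne_zero_iff (K : AbstractSimplicialComplex V) (m : ℕ) (τ : Finset V)
    (σ : K.FacesOfCard m) : K.facetChain F m τ σ ≠ 0 ↔ ∃ v ∈ τ, σ.1 = τ.erase v := by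
  rw [facetChain, Finsupp.finsetSum_apply]
  simp only [faceSingle_apply]
  constructor
  · intro h
    obtain ⟨v, hv, h'⟩ := Finset.exists_ne_zero_of_sum_ne_zero h
    exact ⟨v, hv, by_contra fun hne => h' (if_neg hne)⟩
  · rintro ⟨v, hv, h⟩
    rw [Finset.sum_eq_single_of_mem v hv, if_pos h]
    · exact pow_ne_zero _ (by simp)
    · intro u hu huv
      rw [if_neg]
      rw [h]
      intro he
      have : u ∈ τ.erase v := Finset.mem_erase.2 ⟨huv, hu⟩
      rw [he] at this
      simp at this

theorem boundary_apply (K : AbstractSimplicialComplex V) (m : ℕ) (z : K.Chains F (m + 1))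
    (ρ : K.FacesOfCard m) :
    K.boundary F m z ρ = ∑ σ ∈ z.support, z σ * K.facetChain F m σ.1 ρ := by
  rw [boundary, Finsupp.linearCombination_apply, Finsupp.sum, Finsupp.finsetSum_apply]
  rfl

/-- In a cycle, a facet of a simplex of the support lies in another simplex of the support. -/
theorem exists_other_coface (K : AbstractSimplicialComplex V) {m : ℕ} (hm : 1 ≤ m)
    {z : K.Chains F (m + 1)} (hz : K.boundary F m z = 0) {σ : K.FacesOfCard (m + 1)}
    (hσ : z σ ≠ 0) {u : V} (hu : u ∈ σ.1) :
    ∃ σ' : K.FacesOfCard (m + 1), z σ' ≠ 0 ∧ ∃ w, w ∉ σ.1 ∧ σ'.1 = insert w (σ.1.erase u) := by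
  have hcard : (σ.1.erase u).card = m := by rw [Finset.card_erase_of_mem hu, σ.2.2]; rfl
  let ρ : K.FacesOfCard m := ⟨σ.1.erase u, mem_faces_of_subset σ.2.1 (Finset.erase_subset _ _)
    (Finset.card_pos.1 (by omega)), hcard⟩
  have hρ := DFunLike.congr_fun hz ρ
  rw [boundary_apply, Finsupp.zero_apply] at hρ
  have h1 : z σ * K.facetChain F m σ.1 ρ ≠ 0 :=
    mul_ne_zero hσ ((facetChain_apply_ne_zero_iff K m _ _).2 ⟨u, hu, rfl⟩)
  -- The nonzero contribution of σ to the coefficient at ρ has to be cancelled by another simplex.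
  obtain ⟨σ', hσ', hne, h2⟩ : ∃ σ' ∈ z.support, σ' ≠ σ ∧ z σ' * K.facetChain F m σ'.1 ρ ≠ 0 := by
    by_contra! hcon
    rw [Finset.sum_eq_single_of_mem σ (Finsupp.mem_support_iff.2 hσ) hcon] at hρ
    exact h1 hρ
  obtain ⟨w, hw, he⟩ := (facetChain_apply_ne_zero_iff K m _ _).1 (right_ne_zero_of_mul h2)
  have he' : σ'.1 = insert w (σ.1.erase u) := by
    rw [show σ.1.erase u = σ'.1.erase w from he, Finset.insert_erase hw]
  refine ⟨σ', Finsupp.mem_support_iff.1 hσ', w, fun hwσ => hne ?_, he'⟩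
  have hwu : w = u := by
    by_contra hwu
    have : w ∈ σ.1.erase u := Finset.mem_erase.2 ⟨hwu, hwσ⟩
    rw [show σ.1.erase u = σ'.1.erase w from he] at this
    simp at this
  exact Subtype.ext (by rw [he', hwu, Finset.insert_erase hu])

/-- Induction on the size of the support. Across each facet of a support simplex σ lies another
support simplex, which adds a neighbour of σ. All these neighbours are one vertex w, so every facet
of `insert w σ` is in the support. This simplex is filled, and a multiple of its boundary removes σ
without enlarging the support. -/
theorem cycle_mem_range_boundary (K : AbstractSimplicialComplex V) {k : ℕ} (hk : 1 ≤ k)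
    (hfill : ∀ τ : Finset V, τ.card = k + 2 → (∀ v ∈ τ, τ.erase v ∈ K.faces) → τ ∈ K.faces)
    (hnbr : ∀ σ ∈ K.faces, σ.card = k + 1 → ∀ w ∉ σ, ∀ w' ∉ σ,
      (∃ v ∈ σ, {v, w} ∈ K.faces) → (∃ v ∈ σ, {v, w'} ∈ K.faces) → w = w')
    (z : K.Chains F (k + 1)) (hz : K.boundary F k z = 0) :
    z ∈ LinearMap.range (K.boundary F (k + 1)) := by
  induction hN : z.support.card using Nat.strong_induction_on generalizing z with
  | _ N ih =>
  by_cases hz0 : z = 0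
  · rw [hz0]; exact zero_mem _
  obtain ⟨σ, hσ⟩ := Finsupp.ne_iff.1 hz0
  rw [Finsupp.zero_apply] at hσ
  have hσc := σ.2.2
  have hadj : ∀ (σ' : K.FacesOfCard (k + 1)) (u w : V), u ∈ σ.1 →
      σ'.1 = insert w (σ.1.erase u) → ∃ v ∈ σ.1, {v, w} ∈ K.faces := by
    intro σ' u w hu h
    -- Here k ≥ 1 matters: a vertex of σ survives to be joined to w.
    have : (σ.1.erase u).Nonempty := Finset.card_pos.1 (by
      rw [Finset.card_erase_of_mem hu]; omega)
    obtain ⟨v, hv⟩ := this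
    refine ⟨v, Finset.mem_of_mem_erase hv, mem_faces_of_subset σ'.2.1 ?_ (by simp)⟩
    rw [h]
    intro x hx
    rcases Finset.mem_insert.1 hx with rfl | hx
    · exact Finset.mem_insert_of_mem hv
    · rw [Finset.mem_singleton.1 hx]; exact Finset.mem_insert_self _ _
  obtain ⟨u₀, hu₀⟩ : σ.1.Nonempty := Finset.card_pos.1 (by omega)
  obtain ⟨σ₀, hzσ₀, w, hw, hσ₀⟩ := exists_other_coface K hk hz hσ hu₀
  have hfac : ∀ v ∈ insert w σ.1, ∃ h : (insert w σ.1).erase v ∈ K.faces ∧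
      ((insert w σ.1).erase v).card = k + 1, z ⟨_, h⟩ ≠ 0 := by
    intro v hv
    rcases Finset.mem_insert.1 hv with rfl | hv
    · have : (insert v σ.1).erase v = σ.1 := Finset.erase_insert hw
      refine ⟨by rw [this]; exact σ.2, ?_⟩
      convert hσ
    · obtain ⟨σ', hzσ', w', hw', hσ'⟩ := exists_other_coface K hk hz hσ hv
      obtain rfl : w = w' := hnbr σ.1 σ.2.1 hσc w hw w' hw' (hadj σ₀ u₀ w hu₀ hσ₀)
        (hadj σ' v w' hv hσ')
      have : (insert w σ.1).erase v = σ'.1 := by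
        rw [hσ', Finset.erase_insert_of_ne]
        rintro rfl
        exact hw hv
      refine ⟨by rw [this]; exact σ'.2, ?_⟩
      convert hzσ'
  have hτc : (insert w σ.1).card = k + 2 := by rw [Finset.card_insert_of_notMem hw, hσc]
  have hτ : insert w σ.1 ∈ K.faces := hfill _ hτc fun v hv => (hfac v hv).1.1
  set b : K.Chains F (k + 1) := K.facetChain F (k + 1) (insert w σ.1) with hb
  have hbσ : b σ ≠ 0 := (facetChain_apply_ne_zero_iff K _ _ _).2
    ⟨w, Finset.mem_insert_self _ _, (Finset.erase_insert hw).symm⟩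
  have hbr : b ∈ LinearMap.range (K.boundary F (k + 1)) := by
    refine ⟨K.faceSingle (k + 2) (insert w σ.1) 1, ?_⟩
    rw [boundary_faceSingle K (k + 1) 1 hτ hτc, one_smul]
  have hbz : K.boundary F k b = 0 :=
    boundary_facetChain K k hτc fun v hv => (hfac v hv).1.1
  set c : F := z σ / b σ
  have hsupp : (z - c • b).support ⊂ z.support := by
    rw [Finset.ssubset_iff_of_subset]
    · refine ⟨σ, Finsupp.mem_support_iff.2 hσ, ?_⟩
      simp [c, hbσ]
    · intro σ' hσ'
      rw [Finsupp.mem_support_iff] at hσ' ⊢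
      intro h0
      have hb' : b σ' ≠ 0 := by
        intro hb'
        apply hσ'
        simp [h0, hb']
      obtain ⟨v, hv, he⟩ := (facetChain_apply_ne_zero_iff K _ _ _).1 hb'
      obtain ⟨h, hne⟩ := hfac v hv
      apply hne
      rw [← h0]
      congr 1
      exact Subtype.ext he.symm
  have := ih _ (hN ▸ Finset.card_lt_card hsupp) (z - c • b) (by
    rw [map_sub, map_smul, hz, hbz, smul_zero, sub_zero]) rfl
  simpa using add_mem this (Submodule.smul_mem _ c hbr)

/-- If every hollow `(k + 1)`-simplex is filled and no `k`-simplex has two neighbours, then the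
`k`-th Betti number vanishes. -/
theorem betti_eq_zero (F : Type*) [Field F] (K : AbstractSimplicialComplex V) {k : ℕ} (hk : 1 ≤ k)
    (hfill : ∀ τ : Finset V, τ.card = k + 2 → (∀ v ∈ τ, τ.erase v ∈ K.faces) → τ ∈ K.faces)
    (hnbr : ∀ σ ∈ K.faces, σ.card = k + 1 → ∀ w ∉ σ, ∀ w' ∉ σ,
      (∃ v ∈ σ, {v, w} ∈ K.faces) → (∃ v ∈ σ, {v, w'} ∈ K.faces) → w = w') :
    K.betti F k = 0 := by
  have : Subsingleton (K.Homology F k) := by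
    rw [Submodule.Quotient.subsingleton_iff, eq_top_iff]
    rintro ⟨z, hz⟩ _
    exact cycle_mem_range_boundary K hk hfill hnbr z hz
  exact Module.finrank_zero_of_subsingleton

/-- A hollow `(k + 1)`-simplex none of whose vertices has a neighbour outside is a nontrivial
`k`-cycle. -/
theorem betti_ne_zero (F : Type*) [Field F] [Finite V] (K : AbstractSimplicialComplex V) {k : ℕ}
    {τ : Finset V} (hc : τ.card = k + 2) (hfac : ∀ v ∈ τ, τ.erase v ∈ K.faces)
    (hτ : τ ∉ K.faces) (hiso : ∀ v ∈ τ, ∀ w ∉ τ, {v, w} ∉ K.faces) :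
    K.betti F k ≠ 0 := by
  have hz : K.facetChain F (k + 1) τ ∈ LinearMap.ker (K.boundary F k) :=
    boundary_facetChain K k hc hfac
  have : Nontrivial (K.Homology F k) := by
    rw [Submodule.Quotient.nontrivial_iff]
    intro htop
    have hmem : (⟨_, hz⟩ : LinearMap.ker (K.boundary F k)) ∈
        (LinearMap.range (K.boundary F (k + 1))).submoduleOf (LinearMap.ker (K.boundary F k)) :=
      htop ▸ Submodule.mem_top
    obtain ⟨y, hy⟩ := LinearMap.mem_range.1 (Submodule.mem_comap.1 hmem)
    obtain ⟨v, hv⟩ : τ.Nonempty := Finset.card_pos.1 (by omega)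
    have hcv : (τ.erase v).card = k + 1 := by rw [Finset.card_erase_of_mem hv, hc]; rfl
    let σ : K.FacesOfCard (k + 1) := ⟨τ.erase v, hfac v hv, hcv⟩
    have hne : K.facetChain F (k + 1) τ σ ≠ 0 :=
      (facetChain_apply_ne_zero_iff K _ _ _).2 ⟨v, hv, rfl⟩
    have hne' : K.boundary F (k + 1) y σ ≠ 0 := by rw [hy]; exact hne
    rw [boundary_apply] at hne'
    obtain ⟨τ', _, h'⟩ := Finset.exists_ne_zero_of_sum_ne_zero hne'
    obtain ⟨w, hw, he⟩ := (facetChain_apply_ne_zero_iff K _ _ _).1 (right_ne_zero_of_mul h')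
    have hins : insert w (τ.erase v) = τ'.1 := by
      rw [show τ.erase v = τ'.1.erase w from he, Finset.insert_erase hw]
    have hwv : w ∉ τ.erase v := by
      rw [show τ.erase v = τ'.1.erase w from he]; simp
    -- The coface τ' adds w to a facet of τ. If w ∈ τ, then τ' = τ would be a face; otherwise w is
    -- adjacent to a vertex of τ.
    by_cases hwτ : w ∈ τ
    · obtain rfl : w = v := by
        by_contra hne
        exact hwv (Finset.mem_erase.2 ⟨hne, hwτ⟩)
      rw [Finset.insert_erase hv] at hins
      exact hτ (hins ▸ τ'.2.1)
    · obtain ⟨u, hu⟩ : (τ.erase v).Nonempty := Finset.card_pos.1 (by omega)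
      refine hiso u (Finset.mem_of_mem_erase hu) w hwτ (mem_faces_of_subset τ'.2.1 ?_ (by simp))
      rw [← hins]
      intro x hx
      rcases Finset.mem_insert.1 hx with rfl | hx
      · exact Finset.mem_insert_of_mem hu
      · rw [Finset.mem_singleton.1 hx]; exact Finset.mem_insert_self _ _
  -- Finiteness of V makes the homology finite-dimensional, so `finrank` does not take its default
  -- value 0.
  exact (Module.finrank_pos (R := F) (M := K.Homology F k)).ne'

end AbstractSimplicialComplex

namespace SoftRips

/-! ### Events in product measures -/

section Product

variable {ι : Type*} [Fintype ι]

theorem measureReal_pi_inter_of_disjoint {α : ι → Type*} [∀ i, MeasurableSpace (α i)]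
    (μ : ∀ i, Measure (α i)) [∀ i, IsProbabilityMeasure (μ i)] {S T : Finset ι}
    (hST : Disjoint S T) {A : Set (∀ i : S, α i)} {B : Set (∀ i : T, α i)}
    (hA : MeasurableSet A) (hB : MeasurableSet B) :
    (Measure.pi μ).real ({x | (fun i : S => x i) ∈ A} ∩ {x | (fun i : T => x i) ∈ B}) =
      (Measure.pi μ).real {x | (fun i : S => x i) ∈ A} *
        (Measure.pi μ).real {x | (fun i : T => x i) ∈ B} := by
  have h := (ProbabilityTheory.iIndepFun_pi (μ := μ) (X := fun _ => id)
    fun _ => aemeasurable_id).indepFun_finset S T hST fun i => measurable_pi_apply i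
  have h2 := h.measure_inter_preimage_eq_mul A B hA hB
  simp only [measureReal_def, ← ENNReal.toReal_mul]
  exact congrArg ENNReal.toReal h2

theorem measureReal_pi_forall_mem {α : ι → Type*} [∀ i, MeasurableSpace (α i)]
    (μ : ∀ i, Measure (α i)) [∀ i, IsProbabilityMeasure (μ i)] (S : Finset ι)
    (A : ∀ i, Set (α i)) :
    (Measure.pi μ).real {x | ∀ i ∈ S, x i ∈ A i} = ∏ i ∈ S, (μ i).real (A i) := by
  classical
  have h : {x : ∀ i, α i | ∀ i ∈ S, x i ∈ A i} =
      Set.pi Set.univ fun i => if i ∈ S then A i else Set.univ := by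
    ext x
    simp only [Set.mem_ofPred_eq, Set.mem_pi, Set.mem_univ, forall_const]
    refine forall_congr' fun i => ?_
    by_cases hi : i ∈ S <;> simp [hi]
  rw [h, measureReal_def, Measure.pi_pi, ENNReal.toReal_prod,
    ← Finset.prod_subset (Finset.subset_univ S)]
  · exact Finset.prod_congr rfl fun i hi => by rw [if_pos hi]; rfl
  · intro i _ hi
    simp [hi]

end Product

/-! ### Upper bound for the probability of a cluster -/

section Clustered

variable {ι E : Type*} [PseudoMetricSpace E]

/-- The configurations of points whose restriction to `U` has diameter at most `R`. -/
def clustered (U : Finset ι) (R : ℝ) : Set (ι → E) :=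
  {x | ∀ i ∈ U, ∀ j ∈ U, dist (x i) (x j) ≤ R}

theorem measurableSet_clustered [Finite ι] [MeasurableSpace E] [OpensMeasurableSpace E]
    [SecondCountableTopology E] (U : Finset ι) (R : ℝ) :
    MeasurableSet (clustered U R : Set (ι → E)) := by
  have : IsClosed (clustered U R : Set (ι → E)) := by
    simp only [clustered, Set.ofPred_forall]
    refine isClosed_iInter fun i => isClosed_iInter fun _ => isClosed_iInter fun j =>
      isClosed_iInter fun _ => isClosed_le (by fun_prop) continuous_const
  exact this.measurableSet

/-- Condition on one point of U: the other `U.card - 1` points are independent and must all fall in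
the ball of radius R around it. -/
theorem measureReal_clustered_le [Fintype ι] [MeasurableSpace E] [OpensMeasurableSpace E]
    [SecondCountableTopology E] (ν : Measure E) [IsProbabilityMeasure ν] {R b : ℝ}
    (hb : ∀ a, ν.real (Metric.closedBall a R) ≤ b) {U : Finset ι} (hU : U.Nonempty) :
    (Measure.pi fun _ : ι => ν).real (clustered U R) ≤ b ^ (U.card - 1) := by
  classical
  obtain ⟨i, hi⟩ := hU
  have hmp := measurePreserving_piEquivPiSubtypeProd (fun _ : ι => ν) (fun j => j = i)
  let s : Set (({j // j = i} → E) × ({j // ¬ j = i} → E)) :=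
    {q | ∀ j ∈ (U.subtype fun j => ¬ j = i), q.2 j ∈ Metric.closedBall (q.1 ⟨i, rfl⟩) R}
  have hs : MeasurableSet s := by
    have : IsClosed s := by
      simp only [s, Set.ofPred_forall, Metric.mem_closedBall]
      exact isClosed_iInter fun i => isClosed_iInter fun _ =>
        isClosed_le (by fun_prop) continuous_const
    exact this.measurableSet
  have hb0 : 0 ≤ b := by
    obtain ⟨a⟩ := ν.nonempty_of_neZero
    exact measureReal_nonneg.trans (hb a)
  have hcard : (U.subtype fun j => ¬ j = i).card = U.card - 1 := by
    rw [Finset.card_subtype, ← Finset.card_erase_of_mem hi]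
    congr 1
    ext j
    simp [and_comm]
  have hle : (Measure.pi fun _ : ι => ν) (clustered U R) ≤ ENNReal.ofReal (b ^ (U.card - 1)) := by
    calc (Measure.pi fun _ : ι => ν) (clustered U R)
        ≤ (Measure.pi fun _ : ι => ν)
            (MeasurableEquiv.piEquivPiSubtypeProd (fun _ => E) (fun j => j = i) ⁻¹' s) := by
          refine measure_mono fun x hx j hj => hx j.1 (Finset.mem_subtype.1 hj) i hi
      _ = _ := hmp.measure_preimage hs.nullMeasurableSet
      _ = _ := Measure.prod_apply hs
      _ ≤ ∫⁻ _, ENNReal.ofReal (b ^ (U.card - 1)) ∂_ := by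
          refine lintegral_mono fun a => ?_
          rw [← ENNReal.ofReal_toReal (measure_ne_top _ _), ← measureReal_def]
          refine ENNReal.ofReal_le_ofReal ?_
          refine (measureReal_pi_forall_mem (fun _ : {j // ¬ j = i} => ν) _
            (fun _ => Metric.closedBall (a ⟨i, rfl⟩) R)).le.trans ?_
          rw [Finset.prod_const, hcard]
          gcongr
          exact hb _
      _ = ENNReal.ofReal (b ^ (U.card - 1)) := by simp
  exact ENNReal.toReal_le_of_le_ofReal (by positivity) hle

end Clustered

/-! ### Lower bound for the probability of a cluster -/

section LowerBound

variable {d : ℕ}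

/-- The index of the cube of side `s` containing a point. -/
noncomputable def cubeIndex (s : ℝ) (x : EuclideanSpace ℝ (Fin d)) : Fin d → ℤ := fun i => ⌊x i / s⌋

theorem measurable_cubeIndex (s : ℝ) :
    Measurable (cubeIndex s : EuclideanSpace ℝ (Fin d) → Fin d → ℤ) := by
  unfold cubeIndex
  fun_prop

theorem dist_le_of_cubeIndex_eq {s : ℝ} (hs : 0 < s) {x y : EuclideanSpace ℝ (Fin d)}
    (h : cubeIndex s x = cubeIndex s y) : dist x y ≤ d * s := by
  have hi : ∀ i, |x i - y i| ≤ s := by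
    intro i
    have h1 := Int.abs_sub_lt_one_of_floor_eq_floor (congrFun h i)
    rw [← sub_div, abs_div, abs_of_pos hs, div_lt_one hs] at h1
    exact h1.le
  rw [EuclideanSpace.dist_eq]
  refine Real.sqrt_le_iff.2 ⟨by positivity, ?_⟩
  calc ∑ i, dist (x i) (y i) ^ 2 ≤ ∑ _i : Fin d, s ^ 2 := by
        refine Finset.sum_le_sum fun i _ => ?_
        rw [Real.dist_eq]
        exact pow_le_pow_left₀ (abs_nonneg _) (hi i) 2
    _ = d * s ^ 2 := by simp
    _ ≤ (d * s) ^ 2 := by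
        rw [mul_pow]
        gcongr
        exact_mod_cast Nat.le_self_pow two_ne_zero d

/-- A compact set of mass above 1/2 meets at most a constant times r^(-d) cubes of side r/d, and
points in a common cube form a cluster. The power mean inequality bounds below the sum over cubes of
the (m+1)-st powers of their masses. The constant depends on neither the index type nor r. -/
theorem exists_measureReal_clustered_ge (hd : 1 ≤ d) (ν : Measure (EuclideanSpace ℝ (Fin d)))
    [IsProbabilityMeasure ν] (m : ℕ) :
    ∃ c : ℝ, 0 < c ∧ ∀ (ι : Type) [Fintype ι] (U : Finset ι) (r : ℝ), U.card = m + 1 → 0 < r →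
      r ≤ 1 → c * r ^ (d * m) ≤ (Measure.pi fun _ : ι => ν).real (clustered U r) := by
  obtain ⟨K, -, hK, hνK⟩ := MeasurableSet.univ.exists_lt_isCompact (μ := ν) (r := 1 / 2)
    (by rw [measure_univ]; simp)
  obtain ⟨L, hL1, hL⟩ : ∃ L : ℝ, 1 ≤ L ∧ ∀ x ∈ K, ‖x‖ ≤ L := by
    obtain ⟨L, hL⟩ := hK.isBounded.exists_norm_le
    exact ⟨max L 1, le_max_right _ _, fun x hx => (hL x hx).trans (le_max_left _ _)⟩
  have hd0 : (0 : ℝ) < d := by exact_mod_cast hd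
  refine ⟨(1 / 2) ^ (m + 1) / ((5 * L * d) ^ d) ^ m, by positivity, ?_⟩
  intro ι _ U r hU hr hr1
  classical
  set s : ℝ := r / d with hs
  have hs0 : 0 < s := by positivity
  have hs1 : s ≤ 1 := (div_le_one hd0).2 (hr1.trans (by exact_mod_cast hd))
  set N : ℕ := ⌈L / s⌉₊ with hN
  let Z : Finset (Fin d → ℤ) := Fintype.piFinset fun _ => Finset.Icc (-(N : ℤ)) N
  let g : EuclideanSpace ℝ (Fin d) → Fin d → ℤ := cubeIndex s
  have hLs : 1 ≤ L / s := (one_le_div hs0).2 (hs1.trans hL1)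
  have hNle : (N : ℝ) ≤ 2 * (L / s) := by
    have := (Nat.ceil_lt_add_one (a := L / s) (by positivity)).le
    linarith
  -- The 5 arises from 2N + 1 ≤ 4L/s + 1 ≤ 5L/s, using L/s ≥ 1.
  have hZcard : (Z.card : ℝ) ≤ (5 * L * d) ^ d / r ^ d := by
    have : Z.card = (2 * N + 1) ^ d := by
      simp only [Z, Fintype.card_piFinset, Int.card_Icc, Finset.prod_const, Finset.card_univ,
        Fintype.card_fin]
      congr 1
      omega
    rw [this, ← div_pow]
    push_cast
    refine pow_le_pow_left₀ (by positivity) ?_ d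
    have : 5 * L * d / r = 5 * (L / s) := by rw [hs]; field_simp
    rw [this]
    linarith
  have hmem : ∀ x ∈ K, g x ∈ Z := by
    intro x hx
    refine Fintype.mem_piFinset.2 fun i => Finset.mem_Icc.2 ?_
    have hxi : |x i| ≤ L := (PiLp.norm_apply_le x i).trans (hL x hx)
    have hab : |x i / s| ≤ N := by
      rw [abs_div, abs_of_pos hs0]
      exact (div_le_div_of_nonneg_right hxi hs0.le).trans (Nat.le_ceil _)
    rw [abs_le] at hab
    constructor
    · exact Int.le_floor.2 (by push_cast; exact hab.1)
    · have : (⌊x i / s⌋ : ℝ) ≤ (N : ℝ) := (Int.floor_le _).trans hab.2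
      exact_mod_cast this
  have hgm : ∀ q, MeasurableSet (g ⁻¹' {q}) := fun q =>
    measurable_cubeIndex s (MeasurableSet.singleton q)
  have hhalf : (1 / 2 : ℝ) ≤ ∑ q ∈ Z, ν.real (g ⁻¹' {q}) := by
    rw [← measureReal_biUnion_finset (fun q _ q' _ hqq' => Set.disjoint_left.2
      fun x hx hx' => hqq' (hx.symm.trans hx')) (fun q _ => hgm q) (fun _ _ => measure_ne_top _ _)]
    calc (1 / 2 : ℝ) ≤ ν.real K := by
          rw [measureReal_def, ← ENNReal.toReal_ofReal (show (0 : ℝ) ≤ 1 / 2 by norm_num)]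
          refine ENNReal.toReal_mono (measure_ne_top _ _) (le_trans ?_ hνK.le)
          rw [ENNReal.ofReal_div_of_pos two_pos]
          simp
      _ ≤ _ := by
          refine measureReal_mono (fun x hx => ?_) (measure_ne_top _ _)
          exact Set.mem_biUnion (hmem x hx) rfl
  have hUne : U.Nonempty := Finset.card_pos.1 (by omega)
  have hZpos : 0 < Z.card := by
    rcases Finset.eq_empty_or_nonempty Z with h | h
    · rw [h] at hhalf
      norm_num at hhalf
    · exact Finset.card_pos.2 h
  calc (1 / 2) ^ (m + 1) / ((5 * L * d) ^ d) ^ m * r ^ (d * m)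
      = (1 / 2) ^ (m + 1) / ((5 * L * d) ^ d / r ^ d) ^ m := by
        rw [div_pow _ _ m, pow_mul]
        field_simp
    _ ≤ (∑ q ∈ Z, ν.real (g ⁻¹' {q})) ^ (m + 1) / (Z.card : ℝ) ^ m := by
        gcongr
    _ ≤ ∑ q ∈ Z, ν.real (g ⁻¹' {q}) ^ (m + 1) :=
        pow_sum_div_card_le_sum_pow (fun _ _ => measureReal_nonneg) m
    _ = ∑ q ∈ Z, (Measure.pi fun _ : ι => ν).real {x | ∀ i ∈ U, x i ∈ g ⁻¹' {q}} := by
        refine Finset.sum_congr rfl fun q _ => ?_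
        rw [measureReal_pi_forall_mem (fun _ : ι => ν) U (fun _ => g ⁻¹' {q}),
          Finset.prod_const, hU]
    _ = (Measure.pi fun _ : ι => ν).real (⋃ q ∈ Z, {x | ∀ i ∈ U, x i ∈ g ⁻¹' {q}}) := by
        rw [measureReal_biUnion_finset]
        · intro q _ q' _ hqq'
          obtain ⟨i, hi⟩ := hUne
          exact Set.disjoint_left.2 fun x hx hx' => hqq' ((hx i hi).symm.trans (hx' i hi))
        · intro q _
          simp only [Set.ofPred_forall]
          exact MeasurableSet.iInter fun i => MeasurableSet.iInter fun _ =>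
            (measurable_pi_apply i) (hgm q)
    _ ≤ (Measure.pi fun _ : ι => ν).real (clustered U r) := by
        refine measureReal_mono (Set.iUnion₂_subset fun q _ x hx i hi j hj => ?_)
        have := dist_le_of_cubeIndex_eq hs0 ((hx i hi).trans (hx j hj).symm)
        rwa [hs, mul_div_cancel₀ _ hd0.ne'] at this

end LowerBound

/-! ### First and second moment inequalities for counts -/

section SecondMoment

variable {Ω ι : Type*} [MeasurableSpace Ω] (P : Measure Ω) [IsProbabilityMeasure P]

open Classical in
/-- Chebyshev's inequality for the number of events that occur. -/
theorem measureReal_count_le_half_le (s : Finset ι) {A : ι → Set Ω}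
    (hA : ∀ i, MeasurableSet (A i)) {m v : ℝ} (hm : 0 < m) (hmean : m = ∑ i ∈ s, P.real (A i))
    (hv : ∑ i ∈ s, ∑ j ∈ s, (P.real (A i ∩ A j) - P.real (A i) * P.real (A j)) ≤ v) :
    P.real {ω | ∑ i ∈ s, (A i).indicator (1 : Ω → ℝ) ω ≤ m / 2} ≤ 4 * v / m ^ 2 := by
  have hint : ∀ i, Integrable ((A i).indicator (1 : Ω → ℝ)) P := fun i =>
    (integrable_const (1 : ℝ)).indicator (hA i)
  have hint2 : ∀ i j, Integrable (fun ω => (A i).indicator (1 : Ω → ℝ) ω *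
      (A j).indicator (1 : Ω → ℝ) ω) P := by
    intro i j
    have := (integrable_const (μ := P) (1 : ℝ)).indicator ((hA i).inter (hA j))
    refine this.congr (ae_of_all _ fun ω => ?_)
    simp only [Set.indicator_apply, Set.mem_inter_iff, Pi.one_apply]
    split_ifs <;> simp_all
  have hval2 : ∀ i j, ∫ ω, (A i).indicator (1 : Ω → ℝ) ω * (A j).indicator (1 : Ω → ℝ) ω ∂P =
      P.real (A i ∩ A j) := by
    intro i j
    rw [← integral_indicator_one ((hA i).inter (hA j))]
    congr 1
    ext ω
    simp only [Set.indicator_apply, Set.mem_inter_iff, Pi.one_apply]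
    split_ifs <;> simp_all
  set X : Ω → ℝ := fun ω => ∑ i ∈ s, (A i).indicator (1 : Ω → ℝ) ω with hX
  have hXi : Integrable X P := integrable_finsetSum _ fun i _ => hint i
  have hXsq : ∀ ω, X ω ^ 2 = ∑ i ∈ s, ∑ j ∈ s, (A i).indicator (1 : Ω → ℝ) ω *
      (A j).indicator (1 : Ω → ℝ) ω := fun ω => by rw [sq, hX, Finset.sum_mul_sum]
  have hXsqi : Integrable (fun ω => X ω ^ 2) P := by
    simp only [hXsq]
    exact integrable_finsetSum _ fun i _ => integrable_finsetSum _ fun j _ => hint2 i j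
  have hEX : ∫ ω, X ω ∂P = m := by
    rw [hX, integral_finsetSum _ fun i _ => hint i, hmean]
    exact Finset.sum_congr rfl fun i _ => integral_indicator_one (hA i)
  have hEX2 : ∫ ω, X ω ^ 2 ∂P = ∑ i ∈ s, ∑ j ∈ s, P.real (A i ∩ A j) := by
    simp only [hXsq]
    rw [integral_finsetSum _ fun i _ => integrable_finsetSum _ fun j _ => hint2 i j]
    refine Finset.sum_congr rfl fun i _ => ?_
    rw [integral_finsetSum _ fun j _ => hint2 i j]
    exact Finset.sum_congr rfl fun j _ => hval2 i j
  have hvar : ∫ ω, (X ω - m) ^ 2 ∂P ≤ v := by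
    have h1 : ∀ ω, (X ω - m) ^ 2 = X ω ^ 2 - 2 * m * X ω + m ^ 2 := fun ω => by ring
    simp only [h1]
    rw [integral_add (f := fun ω => X ω ^ 2 - 2 * m * X ω) (hXsqi.sub (hXi.const_mul _))
        (integrable_const _),
      integral_sub hXsqi (hXi.const_mul _), integral_const_mul, hEX, hEX2]
    simp only [integral_const, probReal_univ, smul_eq_mul, one_mul]
    refine le_trans (le_of_eq ?_) hv
    simp only [Finset.sum_sub_distrib]
    rw [← Finset.sum_mul_sum, ← hmean]
    ring
  have hmarkov := mul_meas_ge_le_integral_of_nonneg (μ := P) (f := fun ω => (X ω - m) ^ 2)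
    (ae_of_all _ fun ω => sq_nonneg _) (by
      have : (fun ω => (X ω - m) ^ 2) = fun ω => X ω ^ 2 - 2 * m * X ω + m ^ 2 := by
        ext ω; ring
      rw [this]
      exact (hXsqi.sub (hXi.const_mul _)).add (integrable_const _)) ((m / 2) ^ 2)
  -- A count of at most m/2 deviates from its mean m by at least m/2.
  have hsub : P.real {ω | X ω ≤ m / 2} ≤ P.real {ω | (m / 2) ^ 2 ≤ (X ω - m) ^ 2} := by
    refine measureReal_mono fun ω hω => ?_
    simp only [Set.mem_ofPred_eq] at hω ⊢
    nlinarith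
  rw [le_div_iff₀ (by positivity)]
  nlinarith [hsub, hmarkov, hvar, sq_nonneg m, mul_le_mul_of_nonneg_right hsub (sq_nonneg m)]

/-- Markov's inequality for the number of events that occur. -/
theorem measureReal_le_count_le (s : Finset ι) {A : ι → Set Ω}
    (hA : ∀ i, MeasurableSet (A i)) {a : ℝ} (ha : 0 < a) :
    P.real {ω | a ≤ ∑ i ∈ s, (A i).indicator (1 : Ω → ℝ) ω} ≤ (∑ i ∈ s, P.real (A i)) / a := by
  have hint : ∀ i, Integrable ((A i).indicator (1 : Ω → ℝ)) P := fun i =>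
    (integrable_const (1 : ℝ)).indicator (hA i)
  have h := mul_meas_ge_le_integral_of_nonneg (μ := P)
    (f := fun ω => ∑ i ∈ s, (A i).indicator (1 : Ω → ℝ) ω)
    (ae_of_all _ fun ω => Finset.sum_nonneg fun i _ => Set.indicator_nonneg (by simp) _)
    (integrable_finsetSum _ fun i _ => hint i) a
  rw [integral_finsetSum _ fun i _ => hint i] at h
  rw [le_div_iff₀ ha, mul_comm]
  refine h.trans (le_of_eq (Finset.sum_congr rfl fun i _ => integral_indicator_one (hA i)))

end SecondMoment

end SoftRips

namespace SoftRips

/-! ### Probabilities of coin patterns -/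

section Coins

variable {n : ℕ}

/-- The potential simplices spanned by vertices of `U`. -/
def simplicesIn (U : Finset (Fin n)) : Finset (PotentialSimplex n) :=
  Finset.univ.filter fun σ => σ.1 ⊆ U

theorem mem_simplicesIn {U : Finset (Fin n)} {σ : PotentialSimplex n} :
    σ ∈ simplicesIn U ↔ σ.1 ⊆ U := by
  simp [simplicesIn]

theorem disjoint_simplicesIn {U V : Finset (Fin n)} (h : Disjoint U V) :
    Disjoint (simplicesIn U) (simplicesIn V) := by
  refine Finset.disjoint_left.2 fun σ hU hV => ?_
  have hσ : σ.1 = ∅ := Finset.disjoint_self_iff_empty _ |>.1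
    (h.mono (mem_simplicesIn.1 hU) (mem_simplicesIn.1 hV))
  have h2 := σ.2
  rw [hσ] at h2
  simp at h2

/-- Group the simplices by dimension: m+1 vertices span C(m+1,i+1) of dimension i. -/
theorem prod_simplicesIn (U : Finset (Fin n)) {m : ℕ} (hU : U.card = m + 1) (h : ℕ → ℝ) :
    ∏ σ ∈ simplicesIn U, h (σ.1.card - 1) = ∏ i ∈ Finset.Icc 1 m, h i ^ (m + 1).choose (i + 1) := by
  rw [← Finset.prod_fiberwise_of_maps_to (t := Finset.Icc 1 m) (g := fun σ => σ.1.card - 1)]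
  · refine Finset.prod_congr rfl fun i hi => ?_
    rw [Finset.prod_congr rfl (g := fun _ => h i)
      fun σ hσ => by rw [(Finset.mem_filter.1 hσ).2], Finset.prod_const]
    congr 1
    rw [← hU, ← Finset.card_powersetCard]
    rw [Finset.mem_Icc] at hi
    refine Finset.card_bij (fun σ _ => σ.1) ?_ (fun _ _ _ _ => Subtype.ext) ?_
    · intro σ hσ
      rw [Finset.mem_filter, mem_simplicesIn] at hσ
      have := σ.2
      exact Finset.mem_powersetCard.2 ⟨hσ.1, by omega⟩
    · intro s hs
      rw [Finset.mem_powersetCard] at hs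
      refine ⟨⟨s, by omega⟩, ?_, rfl⟩
      rw [Finset.mem_filter, mem_simplicesIn]
      exact ⟨hs.1, by dsimp only; omega⟩
  · intro σ hσ
    have h1 := Finset.card_le_card (mem_simplicesIn.1 hσ)
    have h2 := σ.2
    exact Finset.mem_Icc.2 ⟨by omega, by omega⟩

/-- The law of the coins. -/
noncomputable def coinLaw (p : ℕ → unitInterval) (n : ℕ) : Measure (PotentialSimplex n → Bool) :=
  Measure.pi fun τ : PotentialSimplex n =>
    ProbabilityTheory.bernoulliMeasure true false (p (τ.1.card - 1))

instance (p : ℕ → unitInterval) (n : ℕ) : IsProbabilityMeasure (coinLaw p n) := by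
  unfold coinLaw
  infer_instance

/-- The coin outcomes under which the simplices in `U` of dimension at most `k`, and no others
in `U`, show `true`. -/
def skeletonCoins (k : ℕ) (U : Finset (Fin n)) : Set (PotentialSimplex n → Bool) :=
  {c | ∀ σ ∈ simplicesIn U, c σ ∈ ({decide (σ.1.card - 1 ≤ k)} : Set Bool)}

/-- The probability that all positive-dimensional faces of dimension at most `k` of a set of `m`
vertices are kept. -/
noncomputable def skeletonProb (p : ℕ → unitInterval) (k m : ℕ) : ℝ :=
  ∏ i ∈ Finset.Icc 1 k, (p i : ℝ) ^ m.choose (i + 1)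

theorem skeletonProb_nonneg (p : ℕ → unitInterval) (k m : ℕ) : 0 ≤ skeletonProb p k m :=
  Finset.prod_nonneg fun i _ => pow_nonneg (p i).2.1 _

/-- On k+1 vertices no simplex exceeds dimension k, so all coins must show `true`. On k+2 vertices
the same event describes a hollow simplex, whose single top coin contributes 1 - p_{k+1}. -/
theorem measureReal_skeletonCoins_face (p : ℕ → unitInterval) {k : ℕ} {U : Finset (Fin n)}
    (hU : U.card = k + 1) :
    (coinLaw p n).real (skeletonCoins k U) = skeletonProb p k (k + 1) := by
  rw [coinLaw, skeletonCoins, measureReal_pi_forall_mem, prod_simplicesIn U hU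
    fun i => (ProbabilityTheory.bernoulliMeasure true false (p i)).real {decide (i ≤ k)}]
  refine Finset.prod_congr rfl fun i hi => ?_
  rw [Finset.mem_Icc] at hi
  simp [hi.2]

theorem measureReal_skeletonCoins_hollow (p : ℕ → unitInterval) {k : ℕ} {U : Finset (Fin n)}
    (hU : U.card = k + 2) :
    (coinLaw p n).real (skeletonCoins k U) = skeletonProb p k (k + 2) * (1 - (p (k + 1) : ℝ)) := by
  rw [coinLaw, skeletonCoins, measureReal_pi_forall_mem, prod_simplicesIn U hU
    fun i => (ProbabilityTheory.bernoulliMeasure true false (p i)).real {decide (i ≤ k)},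
    Finset.prod_Icc_succ_top (by omega)]
  congr 1
  · refine Finset.prod_congr rfl fun i hi => ?_
    rw [Finset.mem_Icc] at hi
    simp [hi.2]
  · simp

end Coins

/-! ### From the complex to clusters and coins -/

section Faces

variable {d n : ℕ} {x : Fin n → EuclideanSpace ℝ (Fin d)} {r : ℝ}

theorem mem_rips_iff (hr : 0 ≤ r) {σ : Finset (Fin n)} :
    σ ∈ (rips x r).faces ↔ σ.Nonempty ∧ x ∈ clustered σ r := by
  refine and_congr_right fun _ => ⟨fun h i hi j hj => ?_, fun h i hi j hj _ => ?_⟩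
  -- The diagonal is the only use of 0 ≤ r: `clustered` includes it, the ball condition does not.
  · by_cases hij : i = j
    · rw [hij, dist_self]; exact hr
    · obtain ⟨y, hy⟩ := h i hi j hj hij
      have h1 := Metric.mem_closedBall'.1 hy.1
      have h2 := Metric.mem_closedBall.1 hy.2
      linarith [dist_triangle (x i) y (x j)]
  · have h' := h i hi j hj
    refine ⟨midpoint ℝ (x i) (x j), ?_, ?_⟩
    · rw [Metric.mem_closedBall, dist_midpoint_left]
      norm_num
      linarith
    · rw [Metric.mem_closedBall, dist_midpoint_right]
      norm_num
      linarith

theorem mem_softRips_iff (hr : 0 ≤ r) {c : PotentialSimplex n → Bool} {σ : Finset (Fin n)} :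
    σ ∈ (softRips x r c).faces ↔
      σ.Nonempty ∧ x ∈ clustered σ r ∧ ∀ τ ∈ simplicesIn σ, c τ = true := by
  have : σ ∈ (softRips x r c).faces ↔
    σ ∈ (rips x r).faces ∧ ∀ τ : PotentialSimplex n, τ.1 ⊆ σ → c τ = true := Iff.rfl
  rw [this, mem_rips_iff hr, and_assoc]
  simp only [mem_simplicesIn]

theorem dist_le_of_pair_mem_softRips (hr : 0 ≤ r) {c : PotentialSimplex n → Bool} {v w : Fin n}
    (h : {v, w} ∈ (softRips x r c).faces) : dist (x v) (x w) ≤ r :=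
  ((mem_softRips_iff hr).1 h).2.1 v (by simp) w (by simp)

/-- Edges to outside neighbours are weakened to distance conditions: each neighbour is within 2r of
all of σ, and two neighbours are within 3r of each other. Only the coins of σ are retained. -/
theorem betti_softRips_eq_zero (F : Type*) [Field F] (hr : 0 ≤ r) {c : PotentialSimplex n → Bool}
    {k : ℕ} (hk : 1 ≤ k)
    (hhollow : ∀ τ : Finset (Fin n), τ.card = k + 2 → x ∈ clustered τ r → c ∉ skeletonCoins k τ)
    (hface : ∀ σ : Finset (Fin n), σ.card = k + 1 → ∀ w ∉ σ, ∀ w' ∉ σ, w ≠ w' →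
      x ∈ clustered (insert w (insert w' σ)) (3 * r) → c ∉ skeletonCoins k σ) :
    (softRips x r c).betti F k = 0 := by
  refine AbstractSimplicialComplex.betti_eq_zero F _ hk ?_ ?_
  · intro τ hτ hfac
    have hτne : τ.Nonempty := Finset.card_pos.1 (by omega)
    have hcl : x ∈ clustered τ r := by
      intro i hi j hj
      -- As k + 2 ≥ 3, any two vertices of τ lie in a common facet.
      obtain ⟨v, hv, hvij⟩ : ∃ v ∈ τ, v ∉ ({i, j} : Finset (Fin n)) :=
        Finset.exists_mem_notMem_of_card_lt_card (Finset.card_le_two.trans_lt (by omega))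
      simp only [Finset.mem_insert, Finset.mem_singleton, not_or] at hvij
      exact ((mem_softRips_iff hr).1 (hfac v hv)).2.1 i
        (Finset.mem_erase.2 ⟨fun h => hvij.1 h.symm, hi⟩) j
        (Finset.mem_erase.2 ⟨fun h => hvij.2 h.symm, hj⟩)
    refine (mem_softRips_iff hr).2 ⟨hτne, hcl, ?_⟩
    have hproper : ∀ σ ∈ simplicesIn τ, σ.1 ≠ τ → c σ = true := by
      intro σ hσ hne
      rw [mem_simplicesIn] at hσ
      obtain ⟨v, hv, hvσ⟩ := Finset.exists_of_ssubset (hσ.ssubset_of_ne hne)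
      exact ((mem_softRips_iff hr).1 (hfac v hv)).2.2 σ
        (mem_simplicesIn.2 (Finset.subset_erase.2 ⟨hσ, hvσ⟩))
    intro σ hσ
    by_contra hcσ
    have hστ : σ.1 = τ := by_contra fun hne => hcσ (hproper σ hσ hne)
    refine hhollow τ hτ hcl fun ρ hρ => ?_
    by_cases hρτ : ρ.1 = τ
    · have : ρ = σ := Subtype.ext (hρτ.trans hστ.symm)
      rw [this, hστ, hτ]
      simpa using hcσ
    · rw [hproper ρ hρ hρτ]
      have := Finset.card_lt_card ((mem_simplicesIn.1 hρ).ssubset_of_ne hρτ)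
      simp
      omega
  · rintro σ hσ hσc w hw w' hw' ⟨v, hv, hvw⟩ ⟨v', hv', hvw'⟩
    by_contra hne
    rw [mem_softRips_iff hr] at hσ
    have h1 := dist_le_of_pair_mem_softRips hr hvw
    have h2 := dist_le_of_pair_mem_softRips hr hvw'
    have hσd := hσ.2.1
    have hwσ : ∀ u ∈ σ, dist (x u) (x w) ≤ 2 * r := fun u hu => by
      linarith [dist_triangle (x u) (x v) (x w), hσd u hu v hv]
    have hwσ' : ∀ u ∈ σ, dist (x u) (x w') ≤ 2 * r := fun u hu => by
      linarith [dist_triangle (x u) (x v') (x w'), hσd u hu v' hv']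
    have hww : dist (x w) (x w') ≤ 3 * r := by
      linarith [dist_triangle (x w) (x v) (x w'), hwσ' v hv, dist_comm (x v) (x w)]
    refine hface σ hσc w hw w' hw' hne ?_ ?_
    · intro i hi j hj
      rw [Finset.mem_insert, Finset.mem_insert] at hi hj
      rcases hi with rfl | rfl | hi <;> rcases hj with rfl | rfl | hj
      · rw [dist_self]; positivity
      · exact hww
      · rw [dist_comm]; linarith [hwσ j hj]
      · rw [dist_comm]; exact hww
      · rw [dist_self]; positivity
      · rw [dist_comm]; linarith [hwσ' j hj]
      · linarith [hwσ i hi]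
      · linarith [hwσ' i hi]
      · linarith [hσd i hi j hj]
    · intro ρ hρ
      rw [hσ.2.2 ρ hρ]
      have := Finset.card_le_card (mem_simplicesIn.1 hρ)
      simp
      omega

/-- Isolation is demanded of the points alone, at scale 2r: a vertex adjacent to one vertex of τ is
within 2r of all of them. -/
theorem betti_softRips_ne_zero (F : Type*) [Field F] (hr : 0 ≤ r) {c : PotentialSimplex n → Bool}
    {k : ℕ} {τ : Finset (Fin n)} (hτ : τ.card = k + 2) (hx : x ∈ clustered τ r)
    (hc : c ∈ skeletonCoins k τ)
    (hiso : ∀ w ∉ τ, x ∉ clustered (insert w τ) (2 * r)) :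
    (softRips x r c).betti F k ≠ 0 := by
  refine AbstractSimplicialComplex.betti_ne_zero F _ hτ ?_ ?_ ?_
  · intro v hv
    have hcard : (τ.erase v).card = k + 1 := by rw [Finset.card_erase_of_mem hv, hτ]; rfl
    refine (mem_softRips_iff hr).2 ⟨Finset.card_pos.1 (by omega),
      fun i hi j hj => hx i (Finset.mem_of_mem_erase hi) j (Finset.mem_of_mem_erase hj),
      fun σ hσ => ?_⟩
    rw [mem_simplicesIn] at hσ
    have h1 : c σ = _ := hc σ (mem_simplicesIn.2 (hσ.trans (Finset.erase_subset _ _)))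
    have h2 := Finset.card_le_card hσ
    rw [h1]
    simp
    omega
  · intro h
    have h1 := ((mem_softRips_iff hr).1 h).2.2 ⟨τ, by omega⟩ (mem_simplicesIn.2 subset_rfl)
    have h2 : c ⟨τ, by omega⟩ = _ := hc ⟨τ, by omega⟩ (mem_simplicesIn.2 subset_rfl)
    rw [h1] at h2
    simp [hτ] at h2
  · intro v hv w hw h
    have h1 := dist_le_of_pair_mem_softRips hr h
    have hwτ : ∀ u ∈ τ, dist (x u) (x w) ≤ 2 * r := fun u hu => by
      linarith [dist_triangle (x u) (x v) (x w), hx u hu v hv]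
    refine hiso w hw fun i hi j hj => ?_
    rw [Finset.mem_insert] at hi hj
    rcases hi with rfl | hi <;> rcases hj with rfl | hj
    · rw [dist_self]; positivity
    · rw [dist_comm]; exact hwτ j hj
    · exact hwτ i hi
    · linarith [hx i hi j hj]

end Faces

end SoftRips

/-! ### Joint events of points and coins -/

namespace SoftRips

variable {d n : ℕ}

theorem measurableSet_skeletonCoins (k : ℕ) (U : Finset (Fin n)) :
    MeasurableSet (skeletonCoins k U) := (Set.toFinite _).measurableSet

/-- The event that the points of `U` have pairwise distance at most `R` and that the simplices in
`V` kept by the coins are those of dimension at most `k`. -/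
def clusterEvent (d : ℕ) (k : ℕ) (R : ℝ) (U V : Finset (Fin n)) : Set (Outcome d n) :=
  clustered U R ×ˢ skeletonCoins k V

theorem measurableSet_clusterEvent (k : ℕ) (R : ℝ) (U V : Finset (Fin n)) :
    MeasurableSet (clusterEvent d k R U V) :=
  (measurableSet_clustered U R).prod (measurableSet_skeletonCoins k V)

variable (ν : Measure (EuclideanSpace ℝ (Fin d))) [IsProbabilityMeasure ν] (p : ℕ → unitInterval)

/-- The joint law of independent points with law `ν` and of the coins. -/
noncomputable def pointCoinLaw (n : ℕ) : Measure (Outcome d n) :=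
  (Measure.pi fun _ : Fin n => ν).prod (coinLaw p n)

instance : IsProbabilityMeasure (pointCoinLaw ν p n) := by
  unfold pointCoinLaw
  infer_instance

theorem measureReal_clusterEvent (ν : Measure (EuclideanSpace ℝ (Fin d))) [SFinite ν]
    (p : ℕ → unitInterval) (k : ℕ) (R : ℝ) (U V : Finset (Fin n)) :
    (pointCoinLaw ν p n).real (clusterEvent d k R U V) =
      (Measure.pi fun _ : Fin n => ν).real (clustered U R) *
        (coinLaw p n).real (skeletonCoins k V) :=
  measureReal_prod_prod _ _

theorem clustered_eq_preimage (U : Finset (Fin n)) (R : ℝ) :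
    (clustered U R : Set (Fin n → EuclideanSpace ℝ (Fin d))) =
      {x | (fun i : U => x i) ∈ clustered Finset.univ R} := by
  ext x
  exact ⟨fun h i _ j _ => h i i.2 j j.2, fun h i hi j hj => h ⟨i, hi⟩ (Finset.mem_univ _) ⟨j, hj⟩
    (Finset.mem_univ _)⟩

/-- Disjoint vertex sets share no point and no potential simplex, hence no coin. -/
theorem measureReal_clusterEvent_inter_of_disjoint (k : ℕ) (R : ℝ) {U V : Finset (Fin n)}
    (hUV : Disjoint U V) :
    (pointCoinLaw ν p n).real (clusterEvent d k R U U ∩ clusterEvent d k R V V) =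
      (pointCoinLaw ν p n).real (clusterEvent d k R U U) *
        (pointCoinLaw ν p n).real (clusterEvent d k R V V) := by
  have h1 : (Measure.pi fun _ : Fin n => ν).real (clustered U R ∩ clustered V R) =
      (Measure.pi fun _ : Fin n => ν).real (clustered U R) *
        (Measure.pi fun _ : Fin n => ν).real (clustered V R) := by
    rw [clustered_eq_preimage U, clustered_eq_preimage V]
    exact measureReal_pi_inter_of_disjoint (fun _ : Fin n => ν) hUV
      (measurableSet_clustered _ _) (measurableSet_clustered _ _)
  have h2 : (coinLaw p n).real (skeletonCoins k U ∩ skeletonCoins k V) =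
      (coinLaw p n).real (skeletonCoins k U) * (coinLaw p n).real (skeletonCoins k V) := by
    have h3 : ∀ W : Finset (Fin n), skeletonCoins k W =
        {c | (fun σ : simplicesIn W => c σ) ∈
          {b : simplicesIn W → Bool | ∀ σ, b σ ∈ ({decide (σ.1.1.card - 1 ≤ k)} : Set Bool)}} := by
      intro W
      ext c
      exact ⟨fun h σ => h σ.1 σ.2, fun h σ hσ => h ⟨σ, hσ⟩⟩
    rw [h3 U, h3 V]
    exact measureReal_pi_inter_of_disjoint _ (disjoint_simplicesIn hUV)
      (Set.toFinite _).measurableSet (Set.toFinite _).measurableSet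
  have h4 : clusterEvent d k R U U ∩ clusterEvent d k R V V =
      (clustered U R ∩ clustered V R) ×ˢ (skeletonCoins k U ∩ skeletonCoins k V) :=
    Set.prod_inter_prod
  rw [h4, pointCoinLaw, measureReal_prod_prod, h1, h2]
  change _ = (pointCoinLaw ν p n).real _ * (pointCoinLaw ν p n).real _
  rw [measureReal_clusterEvent, measureReal_clusterEvent]
  ring

theorem measureReal_clustered_le_pow {r b : ℝ}
    (hb : ∀ a, ν.real (Metric.closedBall a (3 * r)) ≤ b) {R : ℝ} (hR : R ≤ 3 * r)
    {U : Finset (Fin n)} (hU : U.Nonempty) :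
    (Measure.pi fun _ : Fin n => ν).real (clustered U R) ≤ b ^ (U.card - 1) :=
  measureReal_clustered_le ν (fun a => (measureReal_mono
    (Metric.closedBall_subset_closedBall hR)).trans (hb a)) hU

end SoftRips

/-! ### Probability bounds for fixed n -/

namespace SoftRips

variable {d n : ℕ}

theorem card_powersetCard_univ_le (n m : ℕ) :
    ((Finset.powersetCard m (Finset.univ : Finset (Fin n))).card : ℝ) ≤ (n : ℝ) ^ m := by
  rw [Finset.card_powersetCard, Finset.card_univ, Fintype.card_fin]
  exact_mod_cast Nat.choose_le_pow n m

/-- If the `k`-th Betti number does not vanish, then there is a hollow simplex or a simplex with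
two neighbours; this bounds the expected number of these. -/
theorem measureReal_betti_ne_zero_le (F : Type*) [Field F]
    (ν : Measure (EuclideanSpace ℝ (Fin d))) [IsProbabilityMeasure ν] (p : ℕ → unitInterval)
    {k : ℕ} (hk : 1 ≤ k) {r b : ℝ} (hr : 0 ≤ r)
    (hb : ∀ a, ν.real (Metric.closedBall a (3 * r)) ≤ b) :
    (pointCoinLaw ν p n).real {ω | (softRips ω.1 r ω.2).betti F k ≠ 0} ≤
      (n : ℝ) ^ (k + 2) * (b ^ (k + 1) * (skeletonProb p k (k + 2) * (1 - (p (k + 1) : ℝ)))) +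
      (n : ℝ) ^ (k + 3) * (b ^ (k + 2) * skeletonProb p k (k + 1)) := by
  have hb0 : 0 ≤ b := measureReal_nonneg.trans (hb 0)
  let S : Finset (Finset (Fin n)) := Finset.powersetCard (k + 2) Finset.univ
  let T : Finset (Finset (Fin n) × Fin n × Fin n) :=
    (Finset.powersetCard (k + 1) Finset.univ ×ˢ Finset.univ).filter
      fun t => t.2.1 ∉ t.1 ∧ t.2.2 ∉ t.1 ∧ t.2.1 ≠ t.2.2
  have hsub : {ω : Outcome d n | (softRips ω.1 r ω.2).betti F k ≠ 0} ⊆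
      (⋃ τ ∈ S, clusterEvent d k r τ τ) ∪
        ⋃ t ∈ T, clusterEvent d k (3 * r) (insert t.2.1 (insert t.2.2 t.1)) t.1 := by
    intro ω hω
    by_contra hcon
    simp only [Set.mem_union, Set.mem_iUnion, not_or, not_exists] at hcon
    refine hω (betti_softRips_eq_zero F hr hk ?_ ?_)
    · intro τ hτ hx hc
      exact hcon.1 τ (Finset.mem_powersetCard.2 ⟨Finset.subset_univ _, hτ⟩) ⟨hx, hc⟩
    · intro σ hσ w hw w' hw' hne hx hc
      refine hcon.2 (σ, w, w') (Finset.mem_filter.2 ⟨Finset.mem_product.2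
        ⟨Finset.mem_powersetCard.2 ⟨Finset.subset_univ _, hσ⟩, Finset.mem_univ _⟩,
        hw, hw', hne⟩) ⟨hx, hc⟩
  have hS : ∀ τ ∈ S, (pointCoinLaw ν p n).real (clusterEvent d k r τ τ) ≤
      b ^ (k + 1) * (skeletonProb p k (k + 2) * (1 - (p (k + 1) : ℝ))) := by
    intro τ hτ
    have hτc := (Finset.mem_powersetCard.1 hτ).2
    have h := measureReal_clustered_le_pow ν hb (by linarith : r ≤ 3 * r)
      (Finset.card_pos.1 (by omega) : τ.Nonempty)
    rw [hτc] at h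
    rw [measureReal_clusterEvent, measureReal_skeletonCoins_hollow p hτc]
    exact mul_le_mul_of_nonneg_right h (mul_nonneg (skeletonProb_nonneg _ _ _)
      (sub_nonneg.2 (p (k + 1)).2.2))
  have hT : ∀ t ∈ T, (pointCoinLaw ν p n).real
      (clusterEvent d k (3 * r) (insert t.2.1 (insert t.2.2 t.1)) t.1) ≤
      b ^ (k + 2) * skeletonProb p k (k + 1) := by
    intro t ht
    obtain ⟨h1, h2, h3, h4⟩ := Finset.mem_filter.1 ht
    have htc := (Finset.mem_powersetCard.1 (Finset.mem_product.1 h1).1).2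
    have hcard : (insert t.2.1 (insert t.2.2 t.1)).card = k + 3 := by
      rw [Finset.card_insert_of_notMem, Finset.card_insert_of_notMem h3, htc]
      rw [Finset.mem_insert, not_or]
      exact ⟨h4, h2⟩
    have h := measureReal_clustered_le_pow ν hb le_rfl
      (Finset.insert_nonempty t.2.1 (insert t.2.2 t.1))
    rw [hcard] at h
    rw [measureReal_clusterEvent, measureReal_skeletonCoins_face p htc]
    exact mul_le_mul_of_nonneg_right h (skeletonProb_nonneg _ _ _)
  have hTcard : (T.card : ℝ) ≤ (n : ℝ) ^ (k + 3) := by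
    calc (T.card : ℝ)
        ≤ ((Finset.powersetCard (k + 1) Finset.univ ×ˢ
            (Finset.univ : Finset (Fin n × Fin n))).card : ℝ) := by
          exact_mod_cast Finset.card_filter_le _ _
      _ = ((Finset.powersetCard (k + 1) (Finset.univ : Finset (Fin n))).card : ℝ) * (n * n) := by
          rw [Finset.card_product]
          simp
      _ ≤ (n : ℝ) ^ (k + 1) * (n * n) := by
          gcongr
          exact card_powersetCard_univ_le _ _
      _ = (n : ℝ) ^ (k + 3) := by ring
  refine (measureReal_mono hsub).trans ((measureReal_union_le _ _).trans (add_le_add ?_ ?_))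
  · refine (measureReal_biUnion_finset_le _ _).trans ((Finset.sum_le_card_nsmul _ _ _ hS).trans ?_)
    rw [nsmul_eq_mul]
    refine mul_le_mul_of_nonneg_right (card_powersetCard_univ_le _ _) ?_
    exact mul_nonneg (by positivity) (mul_nonneg (skeletonProb_nonneg _ _ _)
      (sub_nonneg.2 (p (k + 1)).2.2))
  · refine (measureReal_biUnion_finset_le _ _).trans ((Finset.sum_le_card_nsmul _ _ _ hT).trans ?_)
    rw [nsmul_eq_mul]
    exact mul_le_mul_of_nonneg_right hTcard (mul_nonneg (by positivity) (skeletonProb_nonneg _ _ _))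

/-- Expand a product over vertices: each vertex of τ contributes 1 + 1 and each other vertex 1 + b.
This sums the covariances over all overlap patterns at once. -/
theorem sum_pow_card_sdiff {b : ℝ} (τ : Finset (Fin n)) :
    ∑ τ' : Finset (Fin n), b ^ (τ' \ τ).card = 2 ^ τ.card * (1 + b) ^ (n - τ.card) := by
  have h1 : ∀ τ' : Finset (Fin n), b ^ (τ' \ τ).card = ∏ i ∈ τ', if i ∈ τ then 1 else b := by
    intro τ'
    rw [Finset.prod_ite, Finset.prod_const_one, one_mul, Finset.prod_const,
      Finset.filter_notMem_eq_sdiff]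
  have h2 : (Finset.univ.filter fun i => i ∉ τ).card = n - τ.card := by
    rw [Finset.filter_not, Finset.filter_mem_eq_inter, Finset.univ_inter,
      Finset.card_sdiff_of_subset (Finset.subset_univ _), Finset.card_univ, Fintype.card_fin]
  simp only [h1]
  rw [← Finset.powerset_univ, ← Finset.prod_one_add]
  have h3 : ∀ i : Fin n, (1 + if i ∈ τ then 1 else b) = if i ∈ τ then 2 else 1 + b := by
    intro i
    split_ifs <;> norm_num
  simp only [h3]
  rw [Finset.prod_ite, Finset.prod_const, Finset.prod_const, h2, Finset.filter_mem_eq_inter,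
    Finset.univ_inter]

/-- If the `k`-th Betti number vanishes, then every hollow simplex has a neighbour; this is ruled
out by the second moment method. -/
theorem measureReal_betti_eq_zero_le (F : Type*) [Field F]
    (ν : Measure (EuclideanSpace ℝ (Fin d))) [IsProbabilityMeasure ν] (p : ℕ → unitInterval)
    {k : ℕ} {r b a q : ℝ} (hr : 0 ≤ r)
    (hb : ∀ a, ν.real (Metric.closedBall a (3 * r)) ≤ b)
    (ha : ∀ U : Finset (Fin n), U.card = k + 2 →
      a ≤ (Measure.pi fun _ : Fin n => ν).real (clustered U r))
    (hq : q = skeletonProb p k (k + 2) * (1 - (p (k + 1) : ℝ)))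
    (hpos : 0 < n.choose (k + 2) * (a * q)) :
    (pointCoinLaw ν p n).real {ω | (softRips ω.1 r ω.2).betti F k = 0} ≤
      4 * ((n : ℝ) ^ (k + 2) * (b ^ (k + 1) * q * (2 ^ (k + 2) * (1 + b) ^ n))) /
        (n.choose (k + 2) * (a * q)) ^ 2 +
      (n : ℝ) ^ (k + 3) * (b ^ (k + 2) * q) / (n.choose (k + 2) * (a * q) / 2) := by
  have hb0 : 0 ≤ b := measureReal_nonneg.trans (hb 0)
  have hq0 : 0 ≤ q := hq ▸ mul_nonneg (skeletonProb_nonneg _ _ _) (sub_nonneg.2 (p (k + 1)).2.2)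
  let S : Finset (Finset (Fin n)) := Finset.powersetCard (k + 2) Finset.univ
  have hScard : ∀ τ ∈ S, τ.card = k + 2 := fun τ hτ => (Finset.mem_powersetCard.1 hτ).2
  let H : Finset (Fin n) → Set (Outcome d n) := fun τ => clusterEvent d k r τ τ
  let T : Finset ((_ : Finset (Fin n)) × Fin n) := S.sigma fun τ => τᶜ
  let G : ((_ : Finset (Fin n)) × Fin n) → Set (Outcome d n) := fun t =>
    clusterEvent d k (2 * r) (insert t.2 t.1) t.1
  set P := pointCoinLaw ν p n
  have hH : ∀ τ, MeasurableSet (H τ) := fun τ => measurableSet_clusterEvent _ _ _ _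
  have hG : ∀ t, MeasurableSet (G t) := fun t => measurableSet_clusterEvent _ _ _ _
  set m : ℝ := ∑ τ ∈ S, P.real (H τ) with hm
  have hm0 : n.choose (k + 2) * (a * q) ≤ m := by
    have h1 : ∀ τ ∈ S, a * q ≤ P.real (H τ) := by
      intro τ hτ
      rw [measureReal_clusterEvent, measureReal_skeletonCoins_hollow p (hScard τ hτ), ← hq]
      exact mul_le_mul_of_nonneg_right (ha τ (hScard τ hτ)) hq0
    have h2 := Finset.card_nsmul_le_sum _ _ _ h1
    rw [nsmul_eq_mul, Finset.card_powersetCard, Finset.card_univ, Fintype.card_fin] at h2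
    exact h2
  have hmpos : 0 < m := hpos.trans_le hm0
  have hpair : ∀ τ ∈ S, ∀ τ' ∈ S, P.real (H τ ∩ H τ') - P.real (H τ) * P.real (H τ') ≤
      b ^ (k + 1) * q * b ^ (τ' \ τ).card := by
    intro τ hτ τ' hτ'
    by_cases hdis : Disjoint τ τ'
    · rw [measureReal_clusterEvent_inter_of_disjoint ν p k r hdis, sub_self]
      positivity
    · obtain ⟨v, hv, hv'⟩ := Finset.not_disjoint_iff.1 hdis
      -- A shared vertex puts the union within 2r; the coins of τ' are dropped.
      have hsub : H τ ∩ H τ' ⊆ clusterEvent d k (2 * r) (τ ∪ τ') τ := by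
        rintro ω ⟨⟨h1, h2⟩, ⟨h3, -⟩⟩
        have hv1 : ∀ i ∈ τ ∪ τ', dist (ω.1 i) (ω.1 v) ≤ r := by
          intro i hi
          rcases Finset.mem_union.1 hi with hi | hi
          · exact h1 i hi v hv
          · exact h3 i hi v hv'
        refine ⟨fun i hi j hj => ?_, h2⟩
        linarith [dist_triangle (ω.1 i) (ω.1 v) (ω.1 j), hv1 i hi, hv1 j hj,
          dist_comm (ω.1 v) (ω.1 j)]
      have h1 := measureReal_clustered_le_pow ν hb (by linarith : 2 * r ≤ 3 * r)
        (⟨v, Finset.mem_union_left _ hv⟩ : (τ ∪ τ').Nonempty)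
      have h2 : (τ ∪ τ').card - 1 = (k + 1) + (τ' \ τ).card := by
        rw [← Finset.union_sdiff_self_eq_union, Finset.card_union_of_disjoint
          Finset.disjoint_sdiff, hScard τ hτ]
        omega
      rw [h2, pow_add] at h1
      have h3 : P.real (H τ ∩ H τ') ≤ b ^ (k + 1) * b ^ (τ' \ τ).card * q := by
        refine (measureReal_mono hsub).trans ?_
        rw [measureReal_clusterEvent, measureReal_skeletonCoins_hollow p (hScard τ hτ), ← hq]
        exact mul_le_mul_of_nonneg_right h1 hq0
      have h4 : 0 ≤ P.real (H τ) * P.real (H τ') := mul_nonneg measureReal_nonneg measureReal_nonneg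
      linarith
  have hvar : ∑ τ ∈ S, ∑ τ' ∈ S, (P.real (H τ ∩ H τ') - P.real (H τ) * P.real (H τ')) ≤
      (n : ℝ) ^ (k + 2) * (b ^ (k + 1) * q * (2 ^ (k + 2) * (1 + b) ^ n)) := by
    have h1 : ∀ τ ∈ S, ∑ τ' ∈ S, (P.real (H τ ∩ H τ') - P.real (H τ) * P.real (H τ')) ≤
        b ^ (k + 1) * q * (2 ^ (k + 2) * (1 + b) ^ n) := by
      intro τ hτ
      calc ∑ τ' ∈ S, (P.real (H τ ∩ H τ') - P.real (H τ) * P.real (H τ'))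
          ≤ ∑ τ' ∈ S, b ^ (k + 1) * q * b ^ (τ' \ τ).card :=
            Finset.sum_le_sum fun τ' hτ' => hpair τ hτ τ' hτ'
        -- Admitting sets τ' of every size gives a sum in closed form.
        _ ≤ ∑ τ', b ^ (k + 1) * q * b ^ (τ' \ τ).card :=
            Finset.sum_le_sum_of_subset_of_nonneg (Finset.subset_univ _)
              fun _ _ _ => by positivity
        _ = b ^ (k + 1) * q * (2 ^ (k + 2) * (1 + b) ^ (n - (k + 2))) := by
            rw [← Finset.mul_sum, sum_pow_card_sdiff, hScard τ hτ]
        _ ≤ _ := by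
            gcongr
            · linarith
            · omega
    refine (Finset.sum_le_card_nsmul _ _ _ h1).trans ?_
    rw [nsmul_eq_mul]
    gcongr
    exact card_powersetCard_univ_le _ _
  have hsub : {ω : Outcome d n | (softRips ω.1 r ω.2).betti F k = 0} ⊆
      {ω | ∑ τ ∈ S, (H τ).indicator (1 : Outcome d n → ℝ) ω ≤ m / 2} ∪
      {ω | m / 2 ≤ ∑ t ∈ T, (G t).indicator (1 : Outcome d n → ℝ) ω} := by
    intro ω hω
    -- With vanishing Betti number, each hollow simplex has at least one nearby outside point.
    have hle : ∑ τ ∈ S, (H τ).indicator (1 : Outcome d n → ℝ) ω ≤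
        ∑ t ∈ T, (G t).indicator (1 : Outcome d n → ℝ) ω := by
      rw [Finset.sum_sigma]
      refine Finset.sum_le_sum fun τ hτ => ?_
      have hnn : ∀ t, 0 ≤ (G t).indicator (1 : Outcome d n → ℝ) ω := fun t =>
        Set.indicator_nonneg (fun _ _ => zero_le_one) _
      by_cases hωτ : ω ∈ H τ
      · obtain ⟨w, hw, hwG⟩ : ∃ w ∉ τ, ω.1 ∈ clustered (insert w τ) (2 * r) := by
          by_contra! hcon
          exact betti_softRips_ne_zero F hr (hScard τ hτ) hωτ.1 hωτ.2 hcon hω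
        have hwG' : ω ∈ G ⟨τ, w⟩ := ⟨hwG, hωτ.2⟩
        rw [Set.indicator_of_mem hωτ]
        refine le_trans (le_of_eq ?_) (Finset.single_le_sum (fun w _ => hnn ⟨τ, w⟩)
          (Finset.mem_compl.2 hw))
        rw [Set.indicator_of_mem hwG']
      · rw [Set.indicator_of_notMem hωτ]
        exact Finset.sum_nonneg fun w _ => hnn ⟨τ, w⟩
    rcases le_total (∑ τ ∈ S, (H τ).indicator (1 : Outcome d n → ℝ) ω) (m / 2) with h | h
    · exact Or.inl h
    · exact Or.inr (h.trans hle)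
  have hT : ∑ t ∈ T, P.real (G t) ≤ (n : ℝ) ^ (k + 3) * (b ^ (k + 2) * q) := by
    have h1 : ∀ t ∈ T, P.real (G t) ≤ b ^ (k + 2) * q := by
      rintro ⟨τ, w⟩ ht
      obtain ⟨hτ, hw⟩ := Finset.mem_sigma.1 ht
      have h := measureReal_clustered_le_pow ν hb (by linarith : 2 * r ≤ 3 * r)
        (Finset.insert_nonempty w τ)
      rw [Finset.card_insert_of_notMem (Finset.mem_compl.1 hw), hScard τ hτ] at h
      rw [measureReal_clusterEvent, measureReal_skeletonCoins_hollow p (hScard τ hτ), ← hq]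
      exact mul_le_mul_of_nonneg_right h hq0
    have hTcard : (T.card : ℝ) ≤ (n : ℝ) ^ (k + 3) := by
      rw [Finset.card_sigma]
      push_cast
      calc ∑ τ ∈ S, (τᶜ.card : ℝ) ≤ ∑ _τ ∈ S, (n : ℝ) := by
            refine Finset.sum_le_sum fun τ _ => ?_
            exact_mod_cast (Finset.card_le_univ _).trans (Fintype.card_fin n).le
        _ = S.card * (n : ℝ) := by rw [Finset.sum_const, nsmul_eq_mul]
        _ ≤ (n : ℝ) ^ (k + 2) * n := by
            gcongr
            exact card_powersetCard_univ_le _ _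
        _ = (n : ℝ) ^ (k + 3) := by ring
    refine (Finset.sum_le_card_nsmul _ _ _ h1).trans ?_
    rw [nsmul_eq_mul]
    gcongr
  refine (measureReal_mono hsub).trans ((measureReal_union_le _ _).trans (add_le_add ?_ ?_))
  · refine (measureReal_count_le_half_le P S hH hmpos hm hvar).trans ?_
    gcongr
  · refine (measureReal_le_count_le P T hG (half_pos hmpos)).trans ?_
    gcongr

end SoftRips

/-! ### Asymptotics -/

namespace SoftRips

/-- Subadditivity on a set and its complement suffices, so the events need not be shown measurable.
-/
theorem tendsto_measure_one_of_compl {Ω : ℕ → Type*} [∀ n, MeasurableSpace (Ω n)]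
    (P : ∀ n, Measure (Ω n)) [∀ n, IsProbabilityMeasure (P n)] {s : ∀ n, Set (Ω n)}
    (h : Tendsto (fun n => (P n).real (s n)ᶜ) atTop (𝓝 0)) :
    Tendsto (fun n => P n (s n)) atTop (𝓝 1) := by
  have hreal : Tendsto (fun n => (P n).real (s n)) atTop (𝓝 1) := by
    have h1 : Tendsto (fun n => 1 - (P n).real (s n)ᶜ) atTop (𝓝 1) := by
      simpa using h.const_sub 1
    refine tendsto_of_tendsto_of_tendsto_of_le_of_le h1 tendsto_const_nhds (fun n => ?_)
      fun n => measureReal_le_one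
    have h2 := measureReal_union_le (μ := P n) (s n) (s n)ᶜ
    rw [Set.union_compl_self, probReal_univ] at h2
    dsimp only
    linarith
  have h3 := ENNReal.tendsto_ofReal hreal
  rw [ENNReal.ofReal_one] at h3
  exact h3.congr fun n => ENNReal.ofReal_toReal (measure_ne_top _ _)

theorem isProbabilityMeasure_withDensity_ofReal {α : Type*} [MeasurableSpace α] {μ : Measure α}
    {f : α → ℝ} (hf_nonneg : ∀ x, 0 ≤ f x) (hf_int : ∫ x, f x ∂μ = 1) :
    IsProbabilityMeasure (μ.withDensity fun x => ENNReal.ofReal (f x)) := by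
  refine ⟨?_⟩
  -- A nonintegrable f would have integral 0 by convention.
  have hint : Integrable f μ := by
    by_contra h
    rw [integral_undef h] at hf_int
    exact zero_ne_one hf_int
  rw [withDensity_apply _ MeasurableSet.univ, Measure.restrict_univ,
    ← ofReal_integral_eq_lintegral_ofReal hint (ae_of_all _ hf_nonneg), hf_int, ENNReal.ofReal_one]

theorem exists_measureReal_closedBall_le {d : ℕ} {f : EuclideanSpace ℝ (Fin d) → ℝ}
    (hf_bdd : ∃ C : ℝ, ∀ᵐ x, f x ≤ C) :
    ∃ B : ℝ, 0 < B ∧ ∀ r : ℝ, 0 ≤ r → ∀ a,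
      (volume.withDensity fun x => ENNReal.ofReal (f x)).real (Metric.closedBall a (3 * r)) ≤
        B * r ^ d := by
  obtain ⟨C, hC⟩ := hf_bdd
  set v : ℝ := volume.real (Metric.ball (0 : EuclideanSpace ℝ (Fin d)) 1)
  have hv : 0 ≤ v := measureReal_nonneg
  refine ⟨|C| * 3 ^ d * v + 1, by positivity, fun r hr a => ?_⟩
  have h1 : (volume.withDensity fun x => ENNReal.ofReal (f x)) (Metric.closedBall a (3 * r)) ≤
      ENNReal.ofReal |C| * volume (Metric.closedBall a (3 * r)) := by
    rw [withDensity_apply _ Metric.isClosed_closedBall.measurableSet, ← setLIntegral_const]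
    refine lintegral_mono_ae (ae_restrict_of_ae (hC.mono fun x hx => ?_))
    exact ENNReal.ofReal_le_ofReal (hx.trans (le_abs_self C))
  have h2 := ENNReal.toReal_mono (ENNReal.mul_ne_top ENNReal.ofReal_ne_top
    (isCompact_closedBall a (3 * r)).measure_ne_top) h1
  rw [ENNReal.toReal_mul, ENNReal.toReal_ofReal (abs_nonneg C)] at h2
  change Measure.real _ _ ≤ |C| * Measure.real _ _ at h2
  rw [Measure.addHaar_real_closedBall volume a (by positivity), finrank_euclideanSpace_fin,
    mul_pow] at h2
  refine h2.trans ?_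
  have : 0 ≤ r ^ d := by positivity
  linarith

theorem exists_mul_pow_le_choose (m : ℕ) :
    ∃ c : ℝ, 0 < c ∧ ∀ n : ℕ, 2 * m ≤ n → c * (n : ℝ) ^ m ≤ n.choose m := by
  refine ⟨1 / (2 ^ m * m.factorial), by positivity, fun n hn => ?_⟩
  refine le_trans ?_ (Nat.pow_le_choose m n)
  have h : (n : ℝ) / 2 ≤ ((n + 1 - m : ℕ) : ℝ) := by
    rw [Nat.cast_sub (by omega)]
    have : 2 * (m : ℝ) ≤ n := by exact_mod_cast hn
    push_cast
    linarith
  calc 1 / (2 ^ m * m.factorial) * (n : ℝ) ^ m = ((n : ℝ) / 2) ^ m / m.factorial := by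
        rw [div_pow]
        field_simp
    _ ≤ _ := by
        gcongr

/-- Pascal's rule C(m+1,i+1) = C(m,i) + C(m,i+1). With m = k+1 the first factor is the product in
the hypothesis. -/
theorem skeletonProb_succ (p : ℕ → unitInterval) (k m : ℕ) :
    skeletonProb p k (m + 1) =
      (∏ i ∈ Finset.Icc 1 k, (p i : ℝ) ^ m.choose i) * skeletonProb p k m := by
  rw [skeletonProb, skeletonProb, ← Finset.prod_mul_distrib]
  refine Finset.prod_congr rfl fun i _ => ?_
  rw [← pow_add, Nat.choose_succ_succ]

end SoftRips

open SoftRips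

theorem theorem3 {F : Type*} [Field F] {d k : ℕ} (hd : 1 ≤ d) (hk : 1 ≤ k)
    (f : EuclideanSpace ℝ (Fin d) → ℝ) (hf_meas : Measurable f) (hf_nonneg : ∀ x, 0 ≤ f x)
    (hf_int : ∫ x, f x = 1) (hf_bdd : ∃ C : ℝ, ∀ᵐ x, f x ≤ C)
    (r : ℕ → ℝ) (hr : ∀ n, 0 ≤ r n)
    (p : ℕ → ℕ → unitInterval)
    (hden : ∀ᶠ n in atTop,
      (1 - (p n (k + 1) : ℝ)) * ∏ i ∈ Finset.Icc 1 k, (p n i : ℝ) ^ (k + 1).choose i ≠ 0)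
    (hsub : Tendsto
      (fun n : ℕ => (n : ℝ) * r n ^ d /
        ((1 - (p n (k + 1) : ℝ)) * ∏ i ∈ Finset.Icc 1 k, (p n i : ℝ) ^ (k + 1).choose i))
      atTop (𝓝 0)) :
    (Tendsto
        (fun n : ℕ => (1 - (p n (k + 1) : ℝ)) *
          (∏ i ∈ Finset.Icc 1 k, (p n i : ℝ) ^ (k + 2).choose (i + 1)) *
          (n : ℝ) ^ (k + 2) * r n ^ (d * (k + 1)))
        atTop (𝓝 0) →
      Tendsto
        (fun n : ℕ => SoftRips.law f (p n) n
          {ω | (SoftRips.softRips ω.1 (r n) ω.2).betti F k = 0})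
        atTop (𝓝 1)) ∧
    (Tendsto
        (fun n : ℕ => (1 - (p n (k + 1) : ℝ)) *
          (∏ i ∈ Finset.Icc 1 k, (p n i : ℝ) ^ (k + 2).choose (i + 1)) *
          (n : ℝ) ^ (k + 2) * r n ^ (d * (k + 1)))
        atTop atTop →
      Tendsto
        (fun n : ℕ => SoftRips.law f (p n) n
          {ω | (SoftRips.softRips ω.1 (r n) ω.2).betti F k ≠ 0})
        atTop (𝓝 1)) := by
  set ν : Measure (EuclideanSpace ℝ (Fin d)) := volume.withDensity fun x => ENNReal.ofReal (f x)
    with hν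
  have hprob : IsProbabilityMeasure ν := isProbabilityMeasure_withDensity_ofReal hf_nonneg hf_int
  have hlaw : ∀ n, law f (p n) n = pointCoinLaw ν (p n) n := fun n => rfl
  obtain ⟨B, hB, hball⟩ := exists_measureReal_closedBall_le hf_bdd
  have hball' : ∀ n a, ν.real (Metric.closedBall a (3 * r n)) ≤ B * r n ^ d :=
    fun n => hball (r n) (hr n)
  set W : ℕ → ℝ := fun n => ∏ i ∈ Finset.Icc 1 k, (p n i : ℝ) ^ (k + 1).choose i with hW
  set Q : ℕ → ℝ := fun n => (1 - (p n (k + 1) : ℝ)) *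
    (∏ i ∈ Finset.Icc 1 k, (p n i : ℝ) ^ (k + 2).choose (i + 1)) *
    (n : ℝ) ^ (k + 2) * r n ^ (d * (k + 1)) with hQ
  have hQ' : ∀ n, Q n = (1 - (p n (k + 1) : ℝ)) * skeletonProb (p n) k (k + 2) *
    (n : ℝ) ^ (k + 2) * r n ^ (d * (k + 1)) := fun n => rfl
  have hS : ∀ n, skeletonProb (p n) k (k + 2) = W n * skeletonProb (p n) k (k + 1) := fun n =>
    skeletonProb_succ (p n) k (k + 1)
  simp only [hlaw]
  constructor
  · intro hQ0
    refine tendsto_measure_one_of_compl _ ?_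
    have hlim : Tendsto (fun n => B ^ (k + 1) * Q n + B ^ (k + 2) * (Q n *
        ((n : ℝ) * r n ^ d / ((1 - (p n (k + 1) : ℝ)) * W n)))) atTop (𝓝 0) := by
      simpa using (hQ0.const_mul (B ^ (k + 1))).add ((hQ0.mul hsub).const_mul (B ^ (k + 2)))
    refine squeeze_zero' (Eventually.of_forall fun n => measureReal_nonneg) ?_ hlim
    filter_upwards [hden] with n hn
    refine (measureReal_betti_ne_zero_le F ν (p n) hk (hr n) (hball' n)).trans (le_of_eq ?_)
    -- The bound for k-faces with two neighbours is, up to B^(k+2), exactly Q times the ratio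
    -- tending to 0.
    have h1 : Q n * ((n : ℝ) * r n ^ d / ((1 - (p n (k + 1) : ℝ)) * W n)) =
        skeletonProb (p n) k (k + 1) * (n : ℝ) ^ (k + 3) * r n ^ (d * (k + 2)) := by
      rw [← mul_div_assoc, div_eq_iff hn, hQ', hS]
      ring
    rw [h1, hQ']
    ring
  · intro hQtop
    refine tendsto_measure_one_of_compl _ ?_
    -- The denominator is at most 1, so n r^d is dominated by the ratio.
    have ht : Tendsto (fun n : ℕ => (n : ℝ) * r n ^ d) atTop (𝓝 0) := by
      refine squeeze_zero' (Eventually.of_forall fun n =>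
        mul_nonneg (Nat.cast_nonneg n) (pow_nonneg (hr n) d)) ?_ hsub
      filter_upwards [hden] with n hn
      have hp0 : 0 ≤ 1 - (p n (k + 1) : ℝ) := sub_nonneg.2 (p n (k + 1)).2.2
      have hW0 : 0 ≤ W n := Finset.prod_nonneg fun i _ => pow_nonneg (p n i).2.1 _
      have hW1 : W n ≤ 1 := Finset.prod_le_one (fun i _ => pow_nonneg (p n i).2.1 _)
        fun i _ => pow_le_one₀ (p n i).2.1 (p n i).2.2
      have hD : (1 - (p n (k + 1) : ℝ)) * W n ≤ 1 :=
        mul_le_one₀ (by linarith [(p n (k + 1)).2.1]) hW0 hW1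
      exact le_div_self (mul_nonneg (Nat.cast_nonneg n) (pow_nonneg (hr n) d))
        (lt_of_le_of_ne (mul_nonneg hp0 hW0) (Ne.symm hn)) hD
    obtain ⟨c, hc, hlow⟩ := exists_measureReal_clustered_ge hd ν (k + 1)
    obtain ⟨e, he, hchoose⟩ := exists_mul_pow_le_choose (k + 2)
    have hlim : Tendsto (fun n : ℕ =>
        4 * (B ^ (k + 1) * 2 ^ (k + 2) * Real.exp B) / (e * c) ^ 2 * (Q n)⁻¹ +
          2 * B ^ (k + 2) / (e * c) * ((n : ℝ) * r n ^ d)) atTop (𝓝 0) := by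
      simpa using (hQtop.inv_tendsto_atTop.const_mul _).add (ht.const_mul _)
    refine squeeze_zero' (Eventually.of_forall fun n => measureReal_nonneg) ?_ hlim
    filter_upwards [hQtop.eventually_gt_atTop 0, ht.eventually_le_const one_pos,
      eventually_ge_atTop (2 * (k + 2))] with n hQn htn hn
    have hn1 : (1 : ℝ) ≤ n := by exact_mod_cast (by omega : 1 ≤ n)
    -- At r = 0 the factor r^(d(k+1)) would make Q vanish.
    have hrpos : 0 < r n := by
      refine lt_of_le_of_ne (hr n) fun h0 => ?_
      rw [hQ', ← h0, zero_pow (by positivity), mul_zero] at hQn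
      exact lt_irrefl _ hQn
    have hrd : r n ^ d ≤ 1 :=
      (le_mul_of_one_le_left (pow_nonneg (hr n) d) hn1).trans htn
    have hr1 : r n ≤ 1 := (pow_le_one_iff_of_nonneg (hr n) (by omega)).1 hrd
    set q : ℝ := skeletonProb (p n) k (k + 2) * (1 - (p n (k + 1) : ℝ)) with hq
    have hQq : Q n = (n : ℝ) ^ (k + 2) * (r n ^ (d * (k + 1)) * q) := by rw [hQ', hq]; ring
    have hq0 : 0 ≤ q := mul_nonneg (skeletonProb_nonneg _ _ _) (sub_nonneg.2 (p n (k + 1)).2.2)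
    have hmean : e * c * Q n ≤ n.choose (k + 2) * (c * r n ^ (d * (k + 1)) * q) := by
      calc e * c * Q n = e * (n : ℝ) ^ (k + 2) * (c * r n ^ (d * (k + 1)) * q) := by
            rw [hQq]; ring
        _ ≤ _ := by
            gcongr
            exact hchoose n hn
    have hpos : 0 < e * c * Q n := by positivity
    -- The sum over overlaps stays bounded because n r^d ≤ 1 eventually.
    have hexp : (1 + B * r n ^ d) ^ n ≤ Real.exp B := by
      calc (1 + B * r n ^ d) ^ n ≤ Real.exp (B * r n ^ d) ^ n := by
            gcongr
            linarith [Real.add_one_le_exp (B * r n ^ d)]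
        _ = Real.exp (B * ((n : ℝ) * r n ^ d)) := by
            rw [← Real.exp_nat_mul]
            congr 1
            ring
        _ ≤ Real.exp B := by
            gcongr
            exact mul_le_of_le_one_right hB.le htn
    have hset : {ω : Outcome d n | (softRips ω.1 (r n) ω.2).betti F k ≠ 0}ᶜ =
        {ω | (softRips ω.1 (r n) ω.2).betti F k = 0} := by
      ext ω
      exact not_not
    rw [hset]
    refine (measureReal_betti_eq_zero_le F ν (p n) (hr n) (hball' n)
      (fun U hU => hlow (Fin n) U (r n) hU hrpos hr1) hq (hpos.trans_le hmean)).trans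
      (add_le_add ?_ ?_)
    -- Variance O(Q) over squared mean of order at least Q² gives O(1/Q).
    · calc 4 * ((n : ℝ) ^ (k + 2) * ((B * r n ^ d) ^ (k + 1) * q *
            (2 ^ (k + 2) * (1 + B * r n ^ d) ^ n))) /
            (n.choose (k + 2) * (c * r n ^ (d * (k + 1)) * q)) ^ 2
          ≤ 4 * ((n : ℝ) ^ (k + 2) * ((B * r n ^ d) ^ (k + 1) * q *
            (2 ^ (k + 2) * Real.exp B))) / (e * c * Q n) ^ 2 := by
            gcongr
        _ = 4 * (B ^ (k + 1) * 2 ^ (k + 2) * Real.exp B) * Q n / (e * c * Q n) ^ 2 := by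
            rw [hQq, mul_pow, pow_mul]
            ring
        _ = _ := by
            field_simp
    -- The expected number O(Qt) of non-isolated hollow simplices, over half the mean, gives O(t).
    · calc (n : ℝ) ^ (k + 3) * ((B * r n ^ d) ^ (k + 2) * q) /
            (n.choose (k + 2) * (c * r n ^ (d * (k + 1)) * q) / 2)
          ≤ (n : ℝ) ^ (k + 3) * ((B * r n ^ d) ^ (k + 2) * q) / (e * c * Q n / 2) := by
            gcongr
        _ = B ^ (k + 2) * ((n : ℝ) * r n ^ d) * Q n / (e * c * Q n / 2) := by
            rw [hQq, mul_pow, pow_mul]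
            ring
        _ = _ := by
            field_simp
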